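/- Let $(p_k)_{k\in\mathbb N}$ be numbers in $(0,1)$, $q_k=1-p_k$, and let $X=(X_k)_{k\in\mathbb N}$ be independent random variables on a probability space $(\Omega,\mathcal A,\mathbb P)$ with $\mathbb P(X_k=1)=p_k$ and $\mathbb P(X_k=-1)=q_k$. Put $Y_k=(X_k-p_k+q_k)/(2\sqrt{p_kq_k})$. For a random variable $F=\mathfrak f(X_1,X_2,\dots)$ let $F_k^{\pm}$ be obtained by replacing $X_k$ by $\pm1$ in $\mathfrak f(X_1,X_2,\dots)$, and let $D_kF=\sqrt{p_kq_k}\,(F_k^+-F_k^-)$. Let $\mathbb D^{1,2}$ be the set of $F\in L^2(\Omega,\sigma\{X\},\mathbb P)$ with $\mathbb E\sum_k (D_kF)^2<\infty$. Every $F\in L^2(\Omega,\sigma\{X\},\mathbb P)$ has a unique expansion $F=\mathbb E[F]+\sum_{n\ge1}J_n(f_n)$ in $L^2$, where $f_n\in\ell^2(\mathbb N^n)$ is symmetric and vanishes on diagonals and $J_n(f)=\sum f(i_1,\dots,i_n)Y_{i_1}\cdots Y_{i_n}$, the sum being over pairwise distinct $i_1,\dots,i_n\in\mathbb N$; put $L^{-1}F=-\sum_{n\ge1}\frac1n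 J_n(f_n)$. For $F,G\in\mathbb D^{1,2}$ define $$\Gamma_0(F,G)=\frac12\sum_{k=1}^\infty (D_kF)(D_kG)+\frac12\sum_{k=1}^\infty (D_kF)(D_kG)Y_k^2 .$$ Let $\Phi$ be the standard normal distribution function and, for $z\in\mathbb R$, let $$f_z(x)=e^{x^2/2}\int_{-\infty}^x\big(\mathbf 1_{\{t\le z\}}-\Phi(z)\big)e^{-t^2/2}\,dt$$ be the bounded solution of Stein's equation $f'(x)-xf(x)=\mathbf 1_{\{x\le z\}}-\Phi(z)$. **Theorem 3.4.** Let $F\in\mathbb D^{1,2}$ have mean zero and variance one, and suppose that $Ff_z(F)+\mathbf 1_{\{F>z\}}\in\mathbb D^{1,2}$ for all $z\in\mathbb R$. Let $N\sim\mathcal N(0,1)$ and let $d_K(F,N)=\sup_{z\in\mathbb R}|\mathbb P(F\le z)-\mathbb P(N\le z)|$. Then $$d_K(F,N)\le \mathbb E\big[\,|1-\Gamma_0(F,-L^{-1}F)|\,\big]+\sup_{z\in\mathbb R}\mathbb E\Big[\sum_{k=1}^\infty D_k\big(Ff_z(F)+\mathbf 1_{\{F>z\}}\big)\,\frac{D_kF}{\sqrt{p_kq_k}}\,|D_kL^{-1}F|\Big],$$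 where all series converge almost surely and all expectations and the supremum on the right-hand side are finite. -/

import Mathlib

open MeasureTheory ProbabilityTheory Filter Topology

namespace Rademacher

variable {Ω : Type*} [MeasurableSpace Ω]

/-- `X` is a sequence of independent random variables on `(Ω, P)` with values `±1`, such that
`P(X k = 1) = p k` and `P(X k = -1) = 1 - p k`, where `0 < p k < 1`. -/
structure IsRademacherSeq (P : Measure Ω) (X : ℕ → Ω → ℝ) (p : ℕ → ℝ) : Prop where
  pos : ∀ k, 0 < p k
  lt_one : ∀ k, p k < 1
  measurable : ∀ k, Measurable (X k)
  indep : iIndepFun X P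
  prob_one : ∀ k, P {ω | X k ω = 1} = ENNReal.ofReal (p k)
  prob_neg_one : ∀ k, P {ω | X k ω = -1} = ENNReal.ofReal (1 - p k)

/-- The normalized variable `Y k = (X k - p k + q k) / (2 √(p k q k))`, `q k = 1 - p k`. -/
noncomputable def Y {α : Type*} (X : ℕ → α → ℝ) (p : ℕ → ℝ) (k : ℕ) (ω : α) : ℝ :=
  (X k ω - p k + (1 - p k)) / (2 * √(p k * (1 - p k)))

/-! ### Functionals of the sequence and the discrete gradient -/

/-- `F = 𝔣(X₁, X₂, …)` almost surely, with a measurable `𝔣`. -/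
def IsRepr (P : Measure Ω) (X : ℕ → Ω → ℝ) (F : Ω → ℝ) (f : (ℕ → ℝ) → ℝ) : Prop :=
  Measurable f ∧ F =ᵐ[P] fun ω => f (fun j => X j ω)

/-- `F` belongs to `L²(Ω, σ(X), P)`: it is square-integrable and almost surely equal to a
measurable function of the sequence `X`. -/
def MemL2 (P : Measure Ω) (X : ℕ → Ω → ℝ) (F : Ω → ℝ) : Prop :=
  MemLp F 2 P ∧ ∃ f, IsRepr P X F f

open Classical in
/-- A function `𝔣` with `F = 𝔣(X₁, X₂, …)` (and `0` if there is none). -/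
noncomputable def repr (P : Measure Ω) (X : ℕ → Ω → ℝ) (F : Ω → ℝ) : (ℕ → ℝ) → ℝ :=
  if h : ∃ f, IsRepr P X F f then h.choose else 0

/-- The discrete gradient `D_k F = √(p_k q_k) (F_k⁺ - F_k⁻)`, where `F_k⁺` and `F_k⁻` are obtained
from `F = 𝔣(X₁, X₂, …)` by setting the `k`-th coordinate to `+1` and to `-1`. Up to null sets it
does not depend on the choice of `𝔣`, see `grad_ae_eq` below. -/
noncomputable def grad (P : Measure Ω) (X : ℕ → Ω → ℝ) (p : ℕ → ℝ) (F : Ω → ℝ) (k : ℕ) (ω : Ω) :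
    ℝ :=
  √(p k * (1 - p k)) *
    (repr P X F (Function.update (fun j => X j ω) k 1)
      - repr P X F (Function.update (fun j => X j ω) k (-1)))

/-- The space `𝔻^{1,2}`: all `F ∈ L²(Ω, σ(X), P)` with `E[∑ₖ (D_k F)²] < ∞`. -/
def MemD12 (P : Measure Ω) (X : ℕ → Ω → ℝ) (p : ℕ → ℝ) (F : Ω → ℝ) : Prop :=
  MemL2 P X F ∧ ∫⁻ ω, ∑' k, ENNReal.ofReal (grad P X p F k ω ^ 2) ∂P < ⊤

/-! ### Chaos expansion and the pseudo-inverse of the Ornstein-Uhlenbeck operator -/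

/-- `∑ᵢ uᵢ = S` with (unconditional) convergence in `L²(P)`. -/
def IsL2Sum {ι : Type*} (P : Measure Ω) (u : ι → Ω → ℝ) (S : Ω → ℝ) : Prop :=
  MemLp S 2 P ∧
    Tendsto (fun A : Finset ι => eLpNorm (fun ω => (∑ i ∈ A, u i ω) - S ω) 2 P) atTop (𝓝 0)

open Classical in
/-- The sum of the series `∑ᵢ uᵢ` in `L²(P)` (and `0` if it does not converge). -/
noncomputable def L2Sum {ι : Type*} (P : Measure Ω) (u : ι → Ω → ℝ) : Ω → ℝ :=
  if h : ∃ S, IsL2Sum P u S then h.choose else 0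

/-- The discrete multiple integral
`J_n(f) = ∑_{(i₁, …, iₙ)} f(i₁, …, iₙ) Y_{i₁} ⋯ Y_{iₙ}`, the sum over pairwise distinct indices. -/
noncomputable def J (P : Measure Ω) (X : ℕ → Ω → ℝ) (p : ℕ → ℝ) (n : ℕ) (f : (Fin n → ℕ) → ℝ) :
    Ω → ℝ :=
  L2Sum P fun (i : Fin n → ℕ) ω =>
    Set.indicator {i : Fin n → ℕ | Function.Injective i} f i * ∏ j, Y X p (i j) ω

/-- Square-summable symmetric kernels on `ℕⁿ` that vanish on diagonals. -/
structure IsKernel (n : ℕ) (f : (Fin n → ℕ) → ℝ) : Prop where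
  summable_sq : Summable fun i => f i ^ 2
  symm : ∀ (σ : Equiv.Perm (Fin n)) (i : Fin n → ℕ), f (i ∘ σ) = f i
  diag : ∀ i : Fin n → ℕ, ¬ Function.Injective i → f i = 0

/-- The kernels `f₁, f₂, …` form the chaos expansion of `F`:
`F = E[F] + ∑_{n ≥ 1} J_n(f_n)` in `L²(P)`. -/
def IsChaosExpansion (P : Measure Ω) (X : ℕ → Ω → ℝ) (p : ℕ → ℝ) (F : Ω → ℝ)
    (f : (n : ℕ+) → (Fin n → ℕ) → ℝ) : Prop :=
  (∀ n : ℕ+, IsKernel n (f n)) ∧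
    IsL2Sum P (fun n : ℕ+ => J P X p n (f n)) (fun ω => F ω - ∫ ω', F ω' ∂P)

open Classical in
/-- `L⁻¹ F = ∑_{n ≥ 1} -(1/n) J_n(f_n)` for `F = E[F] + ∑_{n ≥ 1} J_n(f_n)`
(and `0` if `F` has no chaos expansion). -/
noncomputable def invL (P : Measure Ω) (X : ℕ → Ω → ℝ) (p : ℕ → ℝ) (F : Ω → ℝ) : Ω → ℝ :=
  if h : ∃ f, IsChaosExpansion P X p F f then
    L2Sum P fun (n : ℕ+) ω => -(1 / (n : ℝ)) * J P X p n (h.choose n) ω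
  else 0

/-- `Γ₀(F, G) = ½ ∑ₖ (D_k F)(D_k G) + ½ ∑ₖ (D_k F)(D_k G) Y_k²`. -/
noncomputable def Gamma0 (P : Measure Ω) (X : ℕ → Ω → ℝ) (p : ℕ → ℝ) (F G : Ω → ℝ) (ω : Ω) : ℝ :=
  1 / 2 * ∑' k, grad P X p F k ω * grad P X p G k ω
    + 1 / 2 * ∑' k, grad P X p F k ω * grad P X p G k ω * Y X p k ω ^ 2

/-! ### Stein's equation and the Kolmogorov distance -/

/-- The distribution function `Φ` of the standard normal law. -/
noncomputable def Phi (z : ℝ) : ℝ := (gaussianReal 0 1).real (Set.Iic z)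

/-- The (unique bounded) solution `f_z` of Stein's equation `f'(x) - x f(x) = 1_{x ≤ z} - Φ(z)`:
`f_z(x) = exp(x²/2) ∫_{-∞}^x (1_{t ≤ z} - Φ(z)) exp(-t²/2) dt`. -/
noncomputable def stein (z x : ℝ) : ℝ :=
  Real.exp (x ^ 2 / 2) *
    ∫ t in Set.Iic x, (Set.indicator (Set.Iic z) 1 t - Phi z) * Real.exp (-t ^ 2 / 2)

/-- The random variable `F f_z(F) + 1_{F > z}`. -/
noncomputable def steinVar {α : Type*} (F : α → ℝ) (z : ℝ) (ω : α) : ℝ :=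
  F ω * stein z (F ω) + Set.indicator (Set.Ioi z) 1 (F ω)

/-- The Kolmogorov distance `sup_z |P(F ≤ z) - Q(N ≤ z)|` of two real random variables. -/
noncomputable def dK {Ω' : Type*} [MeasurableSpace Ω'] (P : Measure Ω) (F : Ω → ℝ)
    (Q : Measure Ω') (N : Ω' → ℝ) : ℝ :=
  ⨆ z : ℝ, |P.real {ω | F ω ≤ z} - Q.real {ω | N ω ≤ z}|

/-- The summands of `⟨D(F f_z(F) + 1_{F > z}) DF / √(pq), |D L⁻¹ F|⟩`. -/
noncomputable def remTerm (P : Measure Ω) (X : ℕ → Ω → ℝ) (p : ℕ → ℝ) (F : Ω → ℝ) (z : ℝ) (k : ℕ)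
    (ω : Ω) : ℝ :=
  grad P X p (steinVar F z) k ω * (grad P X p F k ω / √(p k * (1 - p k)))
    * |grad P X p (invL P X p F) k ω|

/-! ### The gradient is well defined -/

lemma update_ae_of_ae {P : Measure Ω} [IsProbabilityMeasure P] {X : ℕ → Ω → ℝ} (k : ℕ) (e : ℝ)
    (hm : ∀ k, Measurable (X k)) (hi : iIndepFun X P) (he : P {ω | X k ω = e} ≠ 0)
    {S : Set (ℕ → ℝ)} (hS : MeasurableSet S) (h : P {ω | (fun j => X j ω) ∈ S} = 0) :
    P {ω | Function.update (fun j => X j ω) k e ∈ S} = 0 := by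
  have hind := indep_iSup_of_disjoint (m := fun j => MeasurableSpace.comap (X j) inferInstance)
    (fun j => (hm j).comap_le) hi (S := {k}) (T := {k}ᶜ) disjoint_compl_right
  rw [Indep_iff] at hind
  have h1 : MeasurableSet[⨆ i ∈ ({k} : Set ℕ), MeasurableSpace.comap (X i) inferInstance]
      {ω | X k ω = e} := by
    have hle : MeasurableSpace.comap (X k) inferInstance ≤
        ⨆ i ∈ ({k} : Set ℕ), MeasurableSpace.comap (X i) inferInstance :=
      le_iSup₂_of_le (f := fun i (_ : i ∈ ({k} : Set ℕ)) =>
        MeasurableSpace.comap (X i) inferInstance) k rfl le_rfl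
    exact hle _ ⟨{e}, measurableSet_singleton e, rfl⟩
  have h2 : MeasurableSet[⨆ i ∈ ({k}ᶜ : Set ℕ), MeasurableSpace.comap (X i) inferInstance]
      {ω | Function.update (fun j => X j ω) k e ∈ S} := by
    suffices hu : Measurable[⨆ i ∈ ({k}ᶜ : Set ℕ), MeasurableSpace.comap (X i) inferInstance]
        (fun ω => Function.update (fun j => X j ω) k e) from hu hS
    refine @measurable_pi_lambda _ _ _ (_) _ _ ?_
    intro a
    by_cases ha : a = k
    · subst ha
      simp only [Function.update_self]
      exact @measurable_const _ _ _ (_) _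
    · simp only [Function.update_of_ne ha]
      have : Measurable[MeasurableSpace.comap (X a) inferInstance] (X a) :=
        comap_measurable (X a)
      exact this.mono (le_iSup₂_of_le (f := fun i (_ : i ∈ ({k}ᶜ : Set ℕ)) =>
        MeasurableSpace.comap (X i) inferInstance) a ha le_rfl) le_rfl
  have h3 := hind _ _ h1 h2
  have h4 : P ({ω | X k ω = e} ∩ {ω | Function.update (fun j => X j ω) k e ∈ S}) = 0 := by
    refine measure_mono_null ?_ h
    rintro ω ⟨h5, h6⟩
    simp only [Set.mem_ofPred_eq] at h5 h6 ⊢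
    rwa [← h5, Function.update_eq_self k (fun j => X j ω)] at h6
  rw [h4] at h3
  exact (mul_eq_zero.mp h3.symm).resolve_left he

/-- Every representation `F = 𝔣(X₁, X₂, …)` computes the discrete gradient, almost surely. -/
lemma grad_ae_eq {P : Measure Ω} [IsProbabilityMeasure P] {X : ℕ → Ω → ℝ} {p : ℕ → ℝ}
    (hX : IsRademacherSeq P X p) {F : Ω → ℝ} {f : (ℕ → ℝ) → ℝ} (hf : IsRepr P X F f) (k : ℕ) :
    grad P X p F k =ᵐ[P] fun ω => √(p k * (1 - p k)) *
      (f (Function.update (fun j => X j ω) k 1) - f (Function.update (fun j => X j ω) k (-1))) := by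
  have hex : ∃ f, IsRepr P X F f := ⟨f, hf⟩
  have hr : IsRepr P X F (repr P X F) := by
    rw [repr, dif_pos hex]
    exact hex.choose_spec
  have hS : MeasurableSet {x | repr P X F x ≠ f x} :=
    (measurableSet_eq_fun hr.1 hf.1).compl
  have h0 : P {ω | (fun j => X j ω) ∈ {x | repr P X F x ≠ f x}} = 0 := by
    have : ∀ᵐ ω ∂P, repr P X F (fun j => X j ω) = f (fun j => X j ω) := by
      filter_upwards [hr.2, hf.2] with ω h1 h2
      rw [← h1, h2]
    exact this
  have hp : P {ω | X k ω = 1} ≠ 0 := by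
    rw [hX.prob_one]
    simpa using hX.pos k
  have hq : P {ω | X k ω = -1} ≠ 0 := by
    rw [hX.prob_neg_one]
    simpa using hX.lt_one k
  have a1 : ∀ᵐ ω ∂P, repr P X F (Function.update (fun j => X j ω) k 1)
      = f (Function.update (fun j => X j ω) k 1) :=
    update_ae_of_ae k 1 hX.measurable hX.indep hp hS h0
  have a2 : ∀ᵐ ω ∂P, repr P X F (Function.update (fun j => X j ω) k (-1))
      = f (Function.update (fun j => X j ω) k (-1)) :=
    update_ae_of_ae k (-1) hX.measurable hX.indep hq hS h0
  filter_upwards [a1, a2] with ω h1 h2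
  rw [grad, h1, h2]

end Rademacher

/-! ### Gaussian tails and the Mills ratio -/

namespace Rademacher

/-! By Stein's equation, `P(F ≤ z) - Φ(z) = E[f_z'(F)] - E[F f_z(F)]`, where `f_z'` is read off from
the equation itself, also at the kink `z`. All quantities depend only on the law of `X`, so the
argument runs on the sequence space, where the finite products of distinct `Y k` (Walsh functions)
form a Hilbert basis of `L²`. There `L⁻¹` divides the coefficient at a nonempty `A` by `-|A|`,
whereas `∑ₖ E[D_k g D_k m]` weights the product of the coefficients at `A` by `|A|`. With `m =
-L⁻¹F` this gives `E[F g] = ∑ₖ E[D_k g D_k m]` (`hasSum_integral_dgrad_mul_of_walshCoef`), used for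
`g = f_z(F)`.

The product `D_k g D_k m` does not involve `X k`, and `(1 + Y_k²)/2` has mean one. Each summand may
therefore be multiplied by this weight (`integral_weight_mul`), and the weighted sum of `D_k F D_k
m` is `Γ₀(F, -L⁻¹F)`.

It remains to compare `D_k f_z(F)` with `f_z'(F) D_k F`. Up to a constant, `f_z'` is the difference
of the nondecreasing functions `x f_z(x)` and `1_{x > z}`. Between `F_k⁻` and `F_k⁺` it thus
deviates from its value at `F`, which is one of the endpoints, by at most the increment of their sum
(`abs_stein_sub_sub_le`). The resulting error is the summand of the second term of the bound; it
ignores `X k`, so its weight disappears under the expectation. The rest is at most `E|1 - Γ₀|`,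
since `|f_z'| ≤ 1`. The supremum is finite because `x f_z(x) + 1_{x > z}` is bounded uniformly in
`z`.

The analytic input on `f_z` comes from `monotone_mul_millsRatio` and `neg_one_le_mul_millsRatio`. -/

/-- The unnormalized Gaussian tail `∫_{-∞}^x exp(-t²/2) dt`. -/
noncomputable def gaussTail (x : ℝ) : ℝ := ∫ t in Set.Iic x, Real.exp (-t ^ 2 / 2)

/-- `exp(x²/2) ∫_{-∞}^x exp(-t²/2) dt`. -/
noncomputable def millsRatio (x : ℝ) : ℝ := Real.exp (x ^ 2 / 2) * gaussTail x

lemma integrable_exp_neg_sq : Integrable fun t : ℝ => Real.exp (-t ^ 2 / 2) := by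
  have := integrable_exp_neg_mul_sq (b := 1 / 2) (by norm_num)
  refine this.congr (ae_of_all _ fun _ => ?_)
  show Real.exp _ = Real.exp _; congr 1; ring

lemma integral_exp_neg_sq : ∫ t : ℝ, Real.exp (-t ^ 2 / 2) = √(2 * Real.pi) := by
  have := integral_gaussian (1 / 2)
  rw [show Real.pi / (1 / 2) = 2 * Real.pi by ring] at this
  rw [← this]
  congr 1; ext t; congr 1; ring

lemma hasDerivAt_exp_neg_sq (x : ℝ) :
    HasDerivAt (fun t : ℝ => Real.exp (-t ^ 2 / 2)) (-x * Real.exp (-x ^ 2 / 2)) x := by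
  have h : HasDerivAt (fun t : ℝ => -t ^ 2 / 2) (-x) x := by
    refine ((hasDerivAt_pow 2 x).neg.div_const 2).congr_deriv ?_
    simp; ring
  exact h.exp.congr_deriv (mul_comm _ _)

lemma hasDerivAt_gaussTail (x : ℝ) : HasDerivAt gaussTail (Real.exp (-x ^ 2 / 2)) x := by
  have hc : Continuous fun t : ℝ => Real.exp (-t ^ 2 / 2) := by fun_prop
  have h : gaussTail = fun x => gaussTail 0 + ∫ t in (0 : ℝ)..x, Real.exp (-t ^ 2 / 2) := by
    ext y
    rw [← intervalIntegral.integral_Iic_sub_Iic integrable_exp_neg_sq.integrableOn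
      integrable_exp_neg_sq.integrableOn]
    simp [gaussTail]
  rw [h]
  exact (intervalIntegral.integral_hasDerivAt_right (hc.intervalIntegrable _ _)
    (hc.stronglyMeasurableAtFilter _ _) hc.continuousAt).const_add _

lemma tendsto_exp_neg_sq_atBot :
    Tendsto (fun t : ℝ => Real.exp (-t ^ 2 / 2)) atBot (𝓝 0) := by
  refine Real.tendsto_exp_atBot.comp ?_
  have h : Tendsto (fun t : ℝ => t ^ 2) atBot atTop := by
    have := (tendsto_pow_atTop (α := ℝ) two_ne_zero).comp tendsto_neg_atBot_atTop
    refine this.congr fun t => ?_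
    simp
  have := (h.atTop_div_const (r := 2) two_pos)
  refine (tendsto_neg_atTop_atBot.comp this).congr fun t => ?_
  simp only [Function.comp]; ring

lemma tendsto_gaussTail_atBot : Tendsto gaussTail atBot (𝓝 0) := by
  have h := intervalIntegral_tendsto_integral_Iic (μ := volume) (0 : ℝ)
    integrable_exp_neg_sq.integrableOn tendsto_id
  have h2 := (h.const_sub (gaussTail 0))
  have : gaussTail 0 - ∫ t in Set.Iic (0:ℝ), Real.exp (-t ^ 2 / 2) = 0 := sub_self _
  rw [this] at h2
  refine h2.congr fun x => ?_
  rw [← intervalIntegral.integral_Iic_sub_Iic integrable_exp_neg_sq.integrableOn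
      integrable_exp_neg_sq.integrableOn]
  simp [gaussTail]

/-- The exponential is the integral of its own derivative `-t exp(-t²/2)` over `(-∞, x]`, where `-t
≥ -x`. -/
lemma exp_add_mul_gaussTail_nonneg (x : ℝ) : 0 ≤ Real.exp (-x ^ 2 / 2) + x * gaussTail x := by
  have hi : Integrable fun t : ℝ => -t * Real.exp (-t ^ 2 / 2) := by
    have := (integrable_mul_exp_neg_mul_sq (b := 1 / 2) (by norm_num)).neg
    refine this.congr (ae_of_all _ fun t => ?_)
    simp only [Pi.neg_apply, neg_mul]; congr 3; ring
  have h := integral_Iic_of_hasDerivAt_of_tendsto' (a := x)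
    (fun t _ => hasDerivAt_exp_neg_sq t) hi.integrableOn tendsto_exp_neg_sq_atBot
  have h2 : -x * gaussTail x ≤ ∫ t in Set.Iic x, -t * Real.exp (-t ^ 2 / 2) := by
    rw [gaussTail, ← integral_const_mul]
    refine setIntegral_mono_on (integrable_exp_neg_sq.integrableOn.const_mul _) hi.integrableOn
      measurableSet_Iic fun t ht => ?_
    have : t ≤ x := ht
    exact mul_le_mul_of_nonneg_right (by linarith) (Real.exp_pos _).le
  linarith

/-- The sharper Mills inequality: `gaussTail t + t/(1+t²) exp(-t²/2)` vanishes at `-∞` and has the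
positive derivative `2 exp(-t²/2)/(1+t²)²`. -/
lemma gaussTail_ge (x : ℝ) :
    0 ≤ (1 + x ^ 2) * gaussTail x + x * Real.exp (-x ^ 2 / 2) := by
  have hpos : ∀ t : ℝ, 0 < 1 + t ^ 2 := fun t => by positivity
  have hd : ∀ t : ℝ, HasDerivAt (fun t => gaussTail t + t / (1 + t ^ 2) * Real.exp (-t ^ 2 / 2))
      (Real.exp (-t ^ 2 / 2) * (2 / (1 + t ^ 2) ^ 2)) t := by
    intro t
    have h1 := ((hasDerivAt_id t).div ((hasDerivAt_pow 2 t).const_add 1) (hpos t).ne').mul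
      (hasDerivAt_exp_neg_sq t)
    refine ((hasDerivAt_gaussTail t).add h1).congr_deriv ?_
    have := (hpos t).ne'
    simp
    field_simp
    ring
  have hm : Monotone fun t => gaussTail t + t / (1 + t ^ 2) * Real.exp (-t ^ 2 / 2) := by
    refine monotone_of_deriv_nonneg (fun t => (hd t).differentiableAt) fun t => ?_
    rw [(hd t).deriv]
    have := Real.exp_pos (-t ^ 2 / 2)
    positivity
  have hl : Tendsto (fun t => gaussTail t + t / (1 + t ^ 2) * Real.exp (-t ^ 2 / 2)) atBot
      (𝓝 0) := by
    have : Tendsto (fun t : ℝ => t / (1 + t ^ 2) * Real.exp (-t ^ 2 / 2)) atBot (𝓝 0) := by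
      refine squeeze_zero_norm (fun t => ?_) tendsto_exp_neg_sq_atBot
      rw [norm_mul, Real.norm_of_nonneg (Real.exp_pos _).le]
      refine mul_le_of_le_one_left (Real.exp_pos _).le ?_
      rw [Real.norm_eq_abs, abs_div, abs_of_pos (hpos t), div_le_one (hpos t)]
      rw [abs_le]; constructor <;> nlinarith
    simpa using tendsto_gaussTail_atBot.add this
  have h := hm.le_of_tendsto hl x
  have h2 := mul_nonneg (hpos x).le h
  have := (hpos x).ne'
  calc (0:ℝ) ≤ _ := h2
    _ = _ := by field_simp

lemma exp_sq_mul_exp_neg_sq (x : ℝ) : Real.exp (x ^ 2 / 2) * Real.exp (-x ^ 2 / 2) = 1 := by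
  rw [← Real.exp_add, ← Real.exp_zero]; congr 1; ring

lemma hasDerivAt_millsRatio (x : ℝ) : HasDerivAt millsRatio (x * millsRatio x + 1) x := by
  have h1 : HasDerivAt (fun t : ℝ => Real.exp (t ^ 2 / 2)) (Real.exp (x ^ 2 / 2) * x) x := by
    convert (((hasDerivAt_pow 2 x).div_const 2).exp) using 1
    simp
  refine (h1.mul (hasDerivAt_gaussTail x)).congr_deriv ?_
  rw [exp_sq_mul_exp_neg_sq, millsRatio]; ring

lemma neg_one_le_mul_millsRatio (x : ℝ) : -1 ≤ x * millsRatio x := by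
  have h := mul_nonneg (Real.exp_pos (x ^ 2 / 2)).le (exp_add_mul_gaussTail_nonneg x)
  rw [mul_add, exp_sq_mul_exp_neg_sq] at h
  rw [millsRatio]; linarith

/-- The derivative is `(1 + x²) millsRatio x + x`, which is `exp(x²/2)` times the quantity in
`gaussTail_ge`. -/
lemma monotone_mul_millsRatio : Monotone fun x => x * millsRatio x := by
  have hd : ∀ t : ℝ, HasDerivAt (fun x => x * millsRatio x)
      (1 * millsRatio t + t * (t * millsRatio t + 1)) t :=
    fun t => (hasDerivAt_id t).mul (hasDerivAt_millsRatio t)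
  refine monotone_of_deriv_nonneg (fun t => (hd t).differentiableAt) fun t => ?_
  rw [(hd t).deriv]
  have h := mul_nonneg (Real.exp_pos (t ^ 2 / 2)).le (gaussTail_ge t)
  rw [mul_add, mul_left_comm _ t, exp_sq_mul_exp_neg_sq] at h
  rw [millsRatio]; linarith

lemma integral_Ioi_exp_neg_sq (x : ℝ) :
    ∫ t in Set.Ioi x, Real.exp (-t ^ 2 / 2) = gaussTail (-x) := by
  have := integral_comp_neg_Iic (-x) (fun t : ℝ => Real.exp (-t ^ 2 / 2))
  rw [neg_neg] at this
  rw [← this, gaussTail]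
  simp

lemma gaussTail_add_gaussTail_neg (x : ℝ) : gaussTail x + gaussTail (-x) = √(2 * Real.pi) := by
  rw [← integral_Ioi_exp_neg_sq, gaussTail, ← Set.compl_Iic,
    integral_add_compl measurableSet_Iic integrable_exp_neg_sq, integral_exp_neg_sq]

lemma Phi_mul_sqrt (z : ℝ) : Phi z * √(2 * Real.pi) = gaussTail z := by
  have hpos : 0 < √(2 * Real.pi) := by positivity
  rw [Phi, Measure.real, gaussianReal_apply_eq_integral _ one_ne_zero,
    ENNReal.toReal_ofReal (integral_nonneg fun t => gaussianPDFReal_nonneg _ _ _)]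
  simp only [gaussianPDFReal, NNReal.coe_one, mul_one, sub_zero]
  rw [integral_const_mul, gaussTail]
  field_simp

lemma Phi_nonneg (z : ℝ) : 0 ≤ Phi z := measureReal_nonneg

lemma Phi_le_one (z : ℝ) : Phi z ≤ 1 := measureReal_le_one

lemma one_sub_Phi_mul_sqrt (z : ℝ) : (1 - Phi z) * √(2 * Real.pi) = gaussTail (-z) := by
  rw [sub_mul, Phi_mul_sqrt, one_mul, ← gaussTail_add_gaussTail_neg z]; ring

/-! ### The solution of Stein's equation -/

lemma stein_of_le {z x : ℝ} (h : x ≤ z) : stein z x = (1 - Phi z) * millsRatio x := by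
  rw [stein, millsRatio, gaussTail, mul_left_comm, ← integral_const_mul (1 - Phi z)]
  congr 1
  refine setIntegral_congr_fun measurableSet_Iic fun t ht => ?_
  have : t ∈ Set.Iic z := le_trans ht h
  simp [Set.indicator_of_mem this]

lemma stein_of_ge {z x : ℝ} (h : z ≤ x) : stein z x = Phi z * millsRatio (-x) := by
  have hi : ∀ s : Set ℝ, IntegrableOn (fun t : ℝ =>
      (Set.indicator (Set.Iic z) 1 t - Phi z) * Real.exp (-t ^ 2 / 2)) s := by
    intro s
    simp only [sub_mul]
    refine Integrable.sub ?_ (integrable_exp_neg_sq.integrableOn.const_mul _)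
    have : (fun t : ℝ => Set.indicator (Set.Iic z) (1 : ℝ → ℝ) t * Real.exp (-t ^ 2 / 2)) =
        Set.indicator (Set.Iic z) fun t => Real.exp (-t ^ 2 / 2) := by
      ext t; by_cases ht : t ∈ Set.Iic z <;> simp [ht]
    rw [this]
    exact (integrable_exp_neg_sq.indicator measurableSet_Iic).integrableOn
  have h1 : ∫ t in Set.Iic z, (Set.indicator (Set.Iic z) 1 t - Phi z) * Real.exp (-t ^ 2 / 2) =
      (1 - Phi z) * gaussTail z := by
    rw [gaussTail, ← integral_const_mul]
    refine setIntegral_congr_fun measurableSet_Iic fun t ht => ?_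
    simp [Set.indicator_of_mem ht]
  have h2 : ∀ y, z ≤ y → ∫ t in Set.Ioi y,
      (Set.indicator (Set.Iic z) 1 t - Phi z) * Real.exp (-t ^ 2 / 2) =
      -(Phi z * gaussTail (-y)) := by
    intro y hy
    rw [← integral_Ioi_exp_neg_sq, ← integral_const_mul, ← integral_neg]
    refine setIntegral_congr_fun measurableSet_Ioi fun t ht => ?_
    have : t ∉ Set.Iic z := fun h => absurd (lt_of_le_of_lt hy ht) (not_lt.2 h)
    simp [Set.indicator_of_notMem this]
  have e1 := intervalIntegral.integral_Iic_add_Ioi (hi (Set.Iic z)) (hi (Set.Ioi z))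
  have e2 := intervalIntegral.integral_Iic_add_Ioi (hi (Set.Iic x)) (hi (Set.Ioi x))
  rw [h1, h2 z le_rfl] at e1
  rw [h2 x h, ← e1] at e2
  -- The integrand has total Gaussian integral zero, so the integral up to `x` is minus the integral
  -- beyond `x`.
  have e3 : (1 - Phi z) * gaussTail z = Phi z * gaussTail (-z) := by
    rw [← Phi_mul_sqrt z, ← one_sub_Phi_mul_sqrt z]; ring
  rw [stein, millsRatio, neg_sq, mul_left_comm]
  congr 1
  linarith

/-- This bounds `x f_z(x)` at `x = z`. The two branches of `f_z` agree there, so the lower bound for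
the Mills ratio at `-z` turns into an upper bound at `z`. -/
lemma mul_millsRatio_mul_le (z : ℝ) : z * millsRatio z * (1 - Phi z) ≤ Phi z := by
  have hpos : 0 < √(2 * Real.pi) := by positivity
  have h := neg_one_le_mul_millsRatio (-z)
  have h1 : millsRatio z * (1 - Phi z) = Phi z * millsRatio (-z) := by
    rw [millsRatio, millsRatio, neg_sq, ← Phi_mul_sqrt, ← one_sub_Phi_mul_sqrt]; ring
  have h2 := mul_le_mul_of_nonneg_left h (Phi_nonneg z)
  rw [mul_assoc, h1]; linarith

lemma mul_millsRatio_neg_mul_le (z : ℝ) : -z * millsRatio (-z) * Phi z ≤ 1 - Phi z := by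
  have h := neg_one_le_mul_millsRatio z
  have h1 : millsRatio z * (1 - Phi z) = Phi z * millsRatio (-z) := by
    rw [millsRatio, millsRatio, neg_sq, ← Phi_mul_sqrt, ← one_sub_Phi_mul_sqrt]; ring
  have h2 := mul_le_mul_of_nonneg_left h (sub_nonneg.2 (Phi_le_one z))
  have h3 : -z * millsRatio (-z) * Phi z = -z * (millsRatio z * (1 - Phi z)) := by rw [h1]; ring
  rw [h3]; linarith

/-- On either side of `z` the function is a nonnegative multiple of `x millsRatio x` or of its odd
reflection `x millsRatio (-x)`; both are nondecreasing. -/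
lemma monotone_mul_stein (z : ℝ) : Monotone fun x => x * stein z x := by
  refine MonotoneOn.Iic_union_Ici (a := z) ?_ ?_
  · intro x hx y hy hxy
    simp only
    rw [stein_of_le hx, stein_of_le hy, mul_left_comm, mul_left_comm y]
    exact mul_le_mul_of_nonneg_left (monotone_mul_millsRatio hxy) (sub_nonneg.2 (Phi_le_one z))
  · intro x hx y hy hxy
    simp only
    rw [stein_of_ge hx, stein_of_ge hy, mul_left_comm, mul_left_comm y]
    have := monotone_mul_millsRatio (neg_le_neg hxy)
    simp only at this
    exact mul_le_mul_of_nonneg_left (by linarith) (Phi_nonneg z)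

/-- Left of `z`, monotonicity reduces the claim to the kink; right of `z`, the elementary Mills
bound at `-x` suffices. -/
lemma mul_stein_le (z x : ℝ) : x * stein z x ≤ Phi z := by
  rcases le_total x z with h | h
  · refine (monotone_mul_stein z h).trans ?_
    simp only
    rw [stein_of_le le_rfl]
    linarith [mul_millsRatio_mul_le z]
  · rw [stein_of_ge h]
    have := mul_le_mul_of_nonneg_left (neg_one_le_mul_millsRatio (-x)) (Phi_nonneg z)
    linarith

lemma le_mul_stein (z x : ℝ) : -(1 - Phi z) ≤ x * stein z x := by
  rcases le_total x z with h | h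
  · rw [stein_of_le h]
    have := mul_le_mul_of_nonneg_left (neg_one_le_mul_millsRatio x)
      (sub_nonneg.2 (Phi_le_one z))
    linarith
  · refine le_trans ?_ (monotone_mul_stein z h)
    simp only
    rw [stein_of_ge le_rfl]
    linarith [mul_millsRatio_neg_mul_le z]

lemma continuous_millsRatio : Continuous millsRatio :=
  continuous_iff_continuousAt.2 fun x => (hasDerivAt_millsRatio x).continuousAt

lemma stein_eq (z : ℝ) : stein z = fun x => if x ≤ z then (1 - Phi z) * millsRatio x
    else Phi z * millsRatio (-x) := by
  ext x
  split_ifs with h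
  · exact stein_of_le h
  · exact stein_of_ge (not_le.1 h).le

lemma continuous_stein (z : ℝ) : Continuous (stein z) := by
  rw [stein_eq]
  refine Continuous.if_le (continuous_const.mul continuous_millsRatio)
    (continuous_const.mul (continuous_millsRatio.comp continuous_neg)) continuous_id
    continuous_const ?_
  rintro x rfl
  rw [← stein_of_le le_rfl, ← stein_of_ge le_rfl]

/-- The derivative `x f_z(x) + 1_{x ≤ z} - Φ(z)` of the solution of Stein's equation. -/
noncomputable def steinDeriv (z x : ℝ) : ℝ :=
  x * stein z x + Set.indicator (Set.Iic z) 1 x - Phi z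

/-- The nondecreasing function `x f_z(x) + 1_{x > z}`. -/
noncomputable def steinMono (z x : ℝ) : ℝ := x * stein z x + Set.indicator (Set.Ioi z) 1 x

lemma monotone_steinMono (z : ℝ) : Monotone (steinMono z) := by
  intro x y h
  have h1 := monotone_mul_stein z h
  have h2 : Set.indicator (Set.Ioi z) (1 : ℝ → ℝ) x ≤ Set.indicator (Set.Ioi z) 1 y := by
    by_cases hx : x ∈ Set.Ioi z
    · have : y ∈ Set.Ioi z := lt_of_lt_of_le hx h
      simp [hx, this]
    · rw [Set.indicator_of_notMem hx]
      exact Set.indicator_nonneg (fun _ _ => zero_le_one) _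
  exact add_le_add h1 h2

lemma abs_steinMono_le (z x : ℝ) : |steinMono z x| ≤ 2 := by
  have h1 := mul_stein_le z x
  have h2 := le_mul_stein z x
  have h3 := Phi_nonneg z
  have h4 := Phi_le_one z
  rw [steinMono, abs_le]
  by_cases hx : x ∈ Set.Ioi z
  · rw [Set.indicator_of_mem hx, Pi.one_apply]; constructor <;> linarith
  · rw [Set.indicator_of_notMem hx]; constructor <;> linarith

lemma abs_steinDeriv_le (z x : ℝ) : |steinDeriv z x| ≤ 1 := by
  have h1 := mul_stein_le z x
  have h2 := le_mul_stein z x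
  have h3 := Phi_nonneg z
  have h4 := Phi_le_one z
  rw [steinDeriv, abs_le]
  by_cases hx : x ∈ Set.Iic z
  · rw [Set.indicator_of_mem hx, Pi.one_apply]; constructor <;> linarith
  · rw [Set.indicator_of_notMem hx]
    constructor <;> linarith

/-- At the kink only the right derivative fits a single formula, and it belongs to the branch `x ≥
z`; hence `Iio` here against `Iic` in `steinDeriv`. The mean value inequality needs no more than
right derivatives. -/
lemma hasDerivWithinAt_stein (z x : ℝ) : HasDerivWithinAt (stein z)
    (x * stein z x + Set.indicator (Set.Iio z) 1 x - Phi z) (Set.Ici x) x := by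
  by_cases h : x < z
  · have hx : x ∈ Set.Iio z := h
    rw [Set.indicator_of_mem hx, stein_of_le h.le]
    refine HasDerivAt.hasDerivWithinAt ?_
    refine (((hasDerivAt_millsRatio x).const_mul (1 - Phi z)).congr_of_eventuallyEq ?_).congr_deriv
      (by simp; ring)
    filter_upwards [Iio_mem_nhds h] with y hy using stein_of_le (le_of_lt hy)
  · have hx : x ∉ Set.Iio z := h
    rw [Set.indicator_of_notMem hx, stein_of_ge (not_lt.1 h)]
    have h1 := ((hasDerivAt_millsRatio (-x)).scomp x (hasDerivAt_neg x)).const_mul (Phi z)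
    refine (h1.hasDerivWithinAt.congr (fun y hy => ?_) ?_).congr_deriv (by simp; ring)
    · exact stein_of_ge ((not_lt.1 h).trans hy)
    · exact stein_of_ge (not_lt.1 h)

/-- After subtracting the linear function with slope `steinDeriv z x`, the right derivative on `[a,
b)` consists of an increment of `t f_z(t)` and an increment of an indicator. Both are monotone and
`x` is an endpoint, so each is controlled by its full increment over `[a, b]`, and the mean value
inequality applies. -/
lemma abs_stein_sub_le_of_le (z : ℝ) {a b : ℝ} (hab : a ≤ b) {x : ℝ} (hx : x = a ∨ x = b) :
    |stein z b - stein z a - steinDeriv z x * (b - a)| ≤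
      (b - a) * (steinMono z b - steinMono z a) := by
  have key := norm_image_sub_le_of_norm_deriv_right_le_segment (a := a) (b := b)
    (f := fun t => stein z t - steinDeriv z x * t)
    (f' := fun t => t * stein z t + Set.indicator (Set.Iio z) 1 t - Phi z - steinDeriv z x)
    (C := steinMono z b - steinMono z a)
    (((continuous_stein z).sub (continuous_const.mul continuous_id)).continuousOn)
    (fun t _ => by
      have := (hasDerivWithinAt_stein z t).sub
        (((hasDerivAt_id t).const_mul (steinDeriv z x)).hasDerivWithinAt)
      refine (this.congr_deriv (by simp)).congr_of_eventuallyEq ?_ ?_ <;> rfl)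
    (fun t ht => by
      have m1 := monotone_mul_stein z ht.1
      have m2 := monotone_mul_stein z ht.2.le
      have m3 := ht.1
      have m4 := ht.2
      simp only at m1 m2
      rw [Real.norm_eq_abs, steinDeriv, steinMono, steinMono, abs_le]
      simp only [Set.indicator, Set.mem_Iio, Set.mem_Iic, Set.mem_Ioi, Pi.one_apply]
      rcases hx with rfl | rfl <;> split_ifs <;> constructor <;> linarith)
    b (Set.right_mem_Icc.2 hab)
  rw [Real.norm_eq_abs] at key
  calc _ = |stein z b - steinDeriv z x * b - (stein z a - steinDeriv z x * a)| := by
        congr 1; ring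
    _ ≤ _ := key
    _ = _ := mul_comm _ _

lemma abs_stein_sub_sub_le (z a b : ℝ) {x : ℝ} (hx : x = a ∨ x = b) :
    |stein z b - stein z a - steinDeriv z x * (b - a)| ≤
      (b - a) * (steinMono z b - steinMono z a) := by
  rcases le_total a b with h | h
  · exact abs_stein_sub_le_of_le z h hx
  · have := abs_stein_sub_le_of_le z h hx.symm
    rw [abs_sub_comm] at this
    convert this using 1
    · congr 1; ring
    · ring

/-- The Lipschitz constant 1 comes from the range of `x f_z(x)`. It puts `f_z(F)` in `L²` and bounds
its gradient by that of `F`. -/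
lemma abs_stein_sub_le (z a b : ℝ) : |stein z b - stein z a| ≤ |b - a| := by
  wlog hab : a ≤ b generalizing a b
  · rw [abs_sub_comm, abs_sub_comm b]; exact this b a (le_of_not_ge hab)
  have key := norm_image_sub_le_of_norm_deriv_right_le_segment (a := a) (b := b)
    (C := 1) (continuous_stein z).continuousOn
    (fun t _ => hasDerivWithinAt_stein z t)
    (fun t _ => by
      have h1 := mul_stein_le z t
      have h2 := le_mul_stein z t
      have h3 := Phi_nonneg z
      have h4 := Phi_le_one z
      rw [Real.norm_eq_abs, abs_le]
      by_cases hx : t ∈ Set.Iio z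
      · rw [Set.indicator_of_mem hx, Pi.one_apply]; constructor <;> linarith
      · rw [Set.indicator_of_notMem hx]; constructor <;> linarith)
    b (Set.right_mem_Icc.2 hab)
  rwa [one_mul, Real.norm_eq_abs, ← abs_of_nonneg (sub_nonneg.2 hab)] at key

lemma measurable_steinMono (z : ℝ) : Measurable (steinMono z) := (monotone_steinMono z).measurable

lemma measurable_steinDeriv (z : ℝ) : Measurable (steinDeriv z) :=
  ((monotone_mul_stein z).measurable.add
    (measurable_one.indicator measurableSet_Iic)).sub measurable_const

end Rademacher

/-! ### The law of the sequence: separating one coordinate from the others -/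

namespace Rademacher
set_option linter.unusedSectionVars false

/-- The coordinate process on the sequence space. -/
abbrev coord : ℕ → (ℕ → ℝ) → ℝ := fun k x => x k

lemma measurableSet_coord_eq (k : ℕ) (e : ℝ) : MeasurableSet {x : ℕ → ℝ | x k = e} :=
  (measurable_pi_apply (X := fun _ => ℝ) k) (measurableSet_singleton e)

section Canonical

variable {Ω : Type*} [MeasurableSpace Ω] {P : Measure Ω} [IsProbabilityMeasure P]
  {X : ℕ → Ω → ℝ} {p : ℕ → ℝ}

lemma IsRademacherSeq.measurable_seq (hX : IsRademacherSeq P X p) :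
    Measurable fun ω j => X j ω := measurable_pi_lambda _ hX.measurable

/-- The law of a Rademacher sequence makes the coordinate process a Rademacher sequence. -/
lemma IsRademacherSeq.map (hX : IsRademacherSeq P X p) :
    IsRademacherSeq (P.map fun ω j => X j ω) coord p where
  pos := hX.pos
  lt_one := hX.lt_one
  measurable := measurable_pi_apply
  indep := by
    have := Measure.isProbabilityMeasure_map (μ := P) hX.measurable_seq.aemeasurable
    rw [iIndepFun_iff_map_fun_eq_infinitePi_map measurable_pi_apply]
    rw [Measure.map_id', hX.indep.map_fun_eq_infinitePi_map hX.measurable]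
    congr 1; ext1 i
    have := fun i => Measure.isProbabilityMeasure_map (μ := P) (hX.measurable i).aemeasurable
    exact (Measure.infinitePi_map_eval (fun i => P.map (X i)) i).symm
  prob_one k := by
    rw [Measure.map_apply hX.measurable_seq (measurableSet_coord_eq k 1)]
    exact hX.prob_one k
  prob_neg_one k := by
    rw [Measure.map_apply hX.measurable_seq (measurableSet_coord_eq k (-1))]
    exact hX.prob_neg_one k

end Canonical

variable {μ : Measure (ℕ → ℝ)} [IsProbabilityMeasure μ] {p : ℕ → ℝ}

namespace IsRademacherSeq

lemma ae_coord (hμ : IsRademacherSeq μ coord p) (k : ℕ) : ∀ᵐ x ∂μ, x k = 1 ∨ x k = -1 := by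
  have hd : Disjoint {x : ℕ → ℝ | x k = 1} {x | x k = -1} := by
    rw [Set.disjoint_left]
    intro x h1 h2
    have h1 : x k = 1 := h1
    have h2 : x k = -1 := h2
    linarith
  have h : μ ({x : ℕ → ℝ | x k = 1} ∪ {x | x k = -1}) = 1 := by
    rw [measure_union hd (measurableSet_coord_eq k _), hμ.prob_one, hμ.prob_neg_one,
      ← ENNReal.ofReal_add (hμ.pos k).le (sub_nonneg.2 (hμ.lt_one k).le)]
    simp
  rw [← prob_compl_eq_zero_iff ((measurableSet_coord_eq k _).union (measurableSet_coord_eq k _))]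
    at h
  exact h

lemma ae_comp_coord (hμ : IsRademacherSeq μ coord p) (k : ℕ) (φ : ℝ → ℝ) :
    (fun x => φ (x k)) =ᵐ[μ] fun x => Set.indicator {1} 1 (x k) * φ 1
      + Set.indicator {-1} 1 (x k) * φ (-1) := by
  have h1 : (1 : ℝ) ≠ -1 := by norm_num
  filter_upwards [hμ.ae_coord k] with x hx
  rcases hx with hx | hx <;> simp [hx, h1, h1.symm]

lemma integral_indicator_one (hμ : IsRademacherSeq μ coord p) (k : ℕ) :
    ∫ x, Set.indicator {1} (1 : ℝ → ℝ) (x k) ∂μ = p k := by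
  have h : (fun x : ℕ → ℝ => Set.indicator {1} (1 : ℝ → ℝ) (x k)) =
      Set.indicator {x | x k = 1} 1 := by
    ext x; simp [Set.indicator]
  rw [h, MeasureTheory.integral_indicator_one (measurableSet_coord_eq k 1), Measure.real, hμ.prob_one,
    ENNReal.toReal_ofReal (hμ.pos k).le]

lemma integral_indicator_neg_one (hμ : IsRademacherSeq μ coord p) (k : ℕ) :
    ∫ x, Set.indicator {-1} (1 : ℝ → ℝ) (x k) ∂μ = 1 - p k := by
  have h : (fun x : ℕ → ℝ => Set.indicator {-1} (1 : ℝ → ℝ) (x k)) =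
      Set.indicator {x | x k = -1} 1 := by
    ext x; simp [Set.indicator]
  rw [h, MeasureTheory.integral_indicator_one (measurableSet_coord_eq k (-1)), Measure.real,
    hμ.prob_neg_one, ENNReal.toReal_ofReal (sub_nonneg.2 (hμ.lt_one k).le)]

lemma memLp_top_comp_coord (hμ : IsRademacherSeq μ coord p) (k : ℕ) {φ : ℝ → ℝ}
    (hφ : Measurable φ) : MemLp (fun x => φ (x k)) ⊤ μ := by
  refine memLp_top_of_bound (hφ.comp (measurable_pi_apply k)).aestronglyMeasurable
    (|φ 1| + |φ (-1)|) ?_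
  filter_upwards [hμ.ae_coord k] with x hx
  rcases hx with hx | hx <;> rw [hx, Real.norm_eq_abs] <;> simp

lemma integral_comp_coord (hμ : IsRademacherSeq μ coord p) (k : ℕ) (φ : ℝ → ℝ) :
    ∫ x, φ (x k) ∂μ = p k * φ 1 + (1 - p k) * φ (-1) := by
  have hi : ∀ e : ℝ, Integrable (fun x : ℕ → ℝ => Set.indicator {e} (1 : ℝ → ℝ) (x k)) μ :=
    fun e => (hμ.memLp_top_comp_coord k
      (measurable_one.indicator (measurableSet_singleton e))).integrable le_top
  rw [integral_congr_ae (hμ.ae_comp_coord k φ),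
    integral_add ((hi _).mul_const _) ((hi _).mul_const _), integral_mul_const, integral_mul_const,
    hμ.integral_indicator_one, hμ.integral_indicator_neg_one]

/-- Overwriting coordinate `k` by the dummy value 0 packs all other coordinates into one map; a
function that ignores coordinate `k` factors through it. -/
lemma indepFun_coord_update (hμ : IsRademacherSeq μ coord p) (k : ℕ) :
    IndepFun (fun x : ℕ → ℝ => x k) (fun x => Function.update x k 0) μ := by
  have hind := indep_iSup_of_disjoint
    (m := fun j => MeasurableSpace.comap (coord j) inferInstance)
    (fun j => (hμ.measurable j).comap_le) hμ.indep (S := {k}) (T := {k}ᶜ) disjoint_compl_right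
  refine indep_of_indep_of_le_left (indep_of_indep_of_le_right hind ?_) ?_
  · rw [← measurable_iff_comap_le]
    refine @measurable_pi_lambda _ _ _ (_) _ _ fun a => ?_
    by_cases ha : a = k
    · subst ha
      simp only [Function.update_self]
      exact @measurable_const _ _ _ (_) _
    · simp only [Function.update_of_ne ha]
      exact (comap_measurable (coord a)).mono
        (le_iSup₂_of_le (f := fun i (_ : i ∈ ({k}ᶜ : Set ℕ)) =>
          MeasurableSpace.comap (coord i) inferInstance) a ha le_rfl) le_rfl
  · exact le_iSup₂_of_le (f := fun i (_ : i ∈ ({k} : Set ℕ)) =>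
        MeasurableSpace.comap (coord i) inferInstance) k rfl le_rfl

/-- Integrals factorize over a function of `x k` and a function that ignores `x k`. -/
lemma integral_coord_mul (hμ : IsRademacherSeq μ coord p) {k : ℕ} {φ : ℝ → ℝ}
    {h : (ℕ → ℝ) → ℝ} (hφ : Measurable φ) (hh : Measurable h)
    (hk : ∀ x, h (Function.update x k 0) = h x) :
    ∫ x, φ (x k) * h x ∂μ = (∫ x, φ (x k) ∂μ) * ∫ x, h x ∂μ := by
  have := (hμ.indepFun_coord_update k).integral_fun_comp_mul_comp
    (measurable_pi_apply k).aemeasurable (measurable_update_left).aemeasurable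
    hφ.aestronglyMeasurable hh.aestronglyMeasurable
  simpa only [hk] using this

/-- Where `x k = e`, freezing the coordinate changes nothing; by independence, freezing therefore
inflates probabilities by at most `1 / μ {x k = e}`. This carries integrability over to `F_k⁺` and
`F_k⁻`. -/
lemma map_update_le (hμ : IsRademacherSeq μ coord p) (k : ℕ) {e : ℝ} (he : e = 1 ∨ e = -1) :
    ∃ c : ENNReal, c ≠ ⊤ ∧ μ.map (fun x => Function.update x k e) ≤ c • μ := by
  have hne : μ {x | x k = e} ≠ 0 := by
    rcases he with rfl | rfl
    · rw [show μ {x | x k = 1} = _ from hμ.prob_one k]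
      simpa using hμ.pos k
    · rw [show μ {x | x k = -1} = _ from hμ.prob_neg_one k]
      simpa using hμ.lt_one k
  refine ⟨(μ {x | x k = e})⁻¹, ENNReal.inv_ne_top.2 hne, ?_⟩
  refine Measure.le_iff.2 fun S hS => ?_
  have hm : Measurable fun x : ℕ → ℝ => Function.update x k e := measurable_update_left
  rw [Measure.map_apply hm hS, Measure.smul_apply, smul_eq_mul]
  have hind := indepFun_iff_measure_inter_preimage_eq_mul.1 (hμ.indepFun_coord_update k) {e}
    ((fun x => Function.update x k e) ⁻¹' S) (measurableSet_singleton e) (hm hS)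
  have h1 : (fun x => Function.update x k (0 : ℝ)) ⁻¹' ((fun x => Function.update x k e) ⁻¹' S) =
      (fun x => Function.update x k e) ⁻¹' S := by
    ext x; simp
  rw [h1] at hind
  have h2 : (fun x : ℕ → ℝ => x k) ⁻¹' {e} ∩ (fun x => Function.update x k e) ⁻¹' S ⊆ S := by
    rintro x ⟨hx, hxS⟩
    have hx : x k = e := hx
    have hxS : Function.update x k e ∈ S := hxS
    rwa [← hx, Function.update_eq_self] at hxS
  have h3 : μ {x | x k = e} * μ ((fun x => Function.update x k e) ⁻¹' S) ≤ μ S := by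
    refine le_trans (le_of_eq ?_) (measure_mono h2)
    exact hind.symm
  calc _ = (μ {x | x k = e})⁻¹ * (μ {x | x k = e} *
      μ ((fun x => Function.update x k e) ⁻¹' S)) := by
        rw [← mul_assoc, ENNReal.inv_mul_cancel hne (measure_ne_top _ _), one_mul]
    _ ≤ _ := by gcongr

lemma memLp_update (hμ : IsRademacherSeq μ coord p) (k : ℕ) {e : ℝ} (he : e = 1 ∨ e = -1)
    {f : (ℕ → ℝ) → ℝ} {r : ENNReal} (hf : MemLp f r μ) :
    MemLp (fun x => f (Function.update x k e)) r μ := by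
  obtain ⟨c, hc, hle⟩ := hμ.map_update_le k he
  exact (hf.of_measure_le_smul hc hle).comp_of_map measurable_update_left.aemeasurable

lemma mul_one_sub_pos (hμ : IsRademacherSeq μ coord p) (k : ℕ) : 0 < p k * (1 - p k) :=
  mul_pos (hμ.pos k) (sub_pos.2 (hμ.lt_one k))

end IsRademacherSeq

/-! ### Walsh functions -/

/-- The value of the normalized variable `Y k` where the `k`-th coordinate is `t`. -/
noncomputable def yValue (p : ℕ → ℝ) (k : ℕ) (t : ℝ) : ℝ :=
  (t - p k + (1 - p k)) / (2 * √(p k * (1 - p k)))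

lemma Y_coord (p : ℕ → ℝ) (k : ℕ) (x : ℕ → ℝ) : Y coord p k x = yValue p k (x k) := rfl

lemma measurable_yValue (p : ℕ → ℝ) (k : ℕ) : Measurable (yValue p k) := by
  unfold yValue; fun_prop

lemma measurable_Y_coord (p : ℕ → ℝ) (k : ℕ) : Measurable (Y coord p k) :=
  (measurable_yValue p k).comp (measurable_pi_apply k)

/-- The Walsh function `∏_{k ∈ A} Y k` on the sequence space. -/
noncomputable def walsh (p : ℕ → ℝ) (A : Finset ℕ) (x : ℕ → ℝ) : ℝ := ∏ k ∈ A, Y coord p k x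

lemma measurable_walsh (p : ℕ → ℝ) (A : Finset ℕ) : Measurable (walsh p A) :=
  Finset.measurable_fun_prod _ fun k _ => measurable_Y_coord p k

lemma walsh_update {p : ℕ → ℝ} {A : Finset ℕ} {k : ℕ} (hk : k ∉ A) (x : ℕ → ℝ) (t : ℝ) :
    walsh p A (Function.update x k t) = walsh p A x := by
  refine Finset.prod_congr rfl fun j hj => ?_
  have : j ≠ k := fun h => hk (h ▸ hj)
  rw [Y_coord, Y_coord, Function.update_of_ne this]

lemma walsh_eq_mul_erase {p : ℕ → ℝ} {A : Finset ℕ} {k : ℕ} (hk : k ∈ A) (x : ℕ → ℝ) :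
    walsh p A x = yValue p k (x k) * walsh p (A.erase k) x :=
  (Finset.mul_prod_erase A (fun k => Y coord p k x) hk).symm

/-- The Walsh coefficient `E[f W_A]`. -/
noncomputable def walshCoef (μ : Measure (ℕ → ℝ)) (p : ℕ → ℝ) (f : (ℕ → ℝ) → ℝ)
    (A : Finset ℕ) : ℝ := ∫ x, f x * walsh p A x ∂μ

namespace IsRademacherSeq

lemma yValue_one (hμ : IsRademacherSeq μ coord p) (k : ℕ) :
    p k * yValue p k 1 = √(p k * (1 - p k)) := by
  have h := hμ.mul_one_sub_pos k
  have h2 := Real.sqrt_pos.2 h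
  rw [yValue, mul_div_assoc', div_eq_iff (by positivity)]
  linear_combination (-2) * Real.mul_self_sqrt h.le

lemma yValue_neg_one (hμ : IsRademacherSeq μ coord p) (k : ℕ) :
    (1 - p k) * yValue p k (-1) = -√(p k * (1 - p k)) := by
  have h := hμ.mul_one_sub_pos k
  have h2 := Real.sqrt_pos.2 h
  rw [yValue, mul_div_assoc', div_eq_iff (by positivity)]
  linear_combination 2 * Real.mul_self_sqrt h.le

lemma integral_yValue (hμ : IsRademacherSeq μ coord p) (k : ℕ) :
    ∫ x, yValue p k (x k) ∂μ = 0 := by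
  rw [hμ.integral_comp_coord, hμ.yValue_one, hμ.yValue_neg_one]; ring

lemma integral_yValue_sq (hμ : IsRademacherSeq μ coord p) (k : ℕ) :
    ∫ x, yValue p k (x k) ^ 2 ∂μ = 1 := by
  have h2 := Real.sqrt_pos.2 (hμ.mul_one_sub_pos k)
  rw [hμ.integral_comp_coord k (fun t => yValue p k t ^ 2), pow_two, pow_two, ← mul_assoc,
    ← mul_assoc, hμ.yValue_one, hμ.yValue_neg_one, yValue, yValue]
  field_simp
  ring

lemma memLp_top_walsh (hμ : IsRademacherSeq μ coord p) (A : Finset ℕ) :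
    MemLp (walsh p A) ⊤ μ := by
  induction A using Finset.induction_on with
  | empty => exact (memLp_const (1 : ℝ)).ae_eq (ae_of_all _ fun x => by simp [walsh])
  | insert k A hk ih =>
    have h : walsh p (insert k A) = (fun x => yValue p k (x k)) * walsh p A := by
      ext x; exact Finset.prod_insert hk
    rw [h]
    exact ih.mul (hμ.memLp_top_comp_coord k (measurable_yValue p k))

lemma memLp_walsh (hμ : IsRademacherSeq μ coord p) (A : Finset ℕ) :
    MemLp (walsh p A) 2 μ := (hμ.memLp_top_walsh A).mono_exponent le_top

lemma integral_walsh_mul_self (hμ : IsRademacherSeq μ coord p) (A : Finset ℕ) :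
    ∫ x, walsh p A x * walsh p A x ∂μ = 1 := by
  induction A using Finset.induction_on with
  | empty => simp [walsh]
  | insert k A hk ih =>
    have h : ∀ x, walsh p (insert k A) x * walsh p (insert k A) x =
        yValue p k (x k) ^ 2 * (walsh p A x * walsh p A x) := by
      intro x
      rw [walsh_eq_mul_erase (Finset.mem_insert_self k A), Finset.erase_insert hk]; ring
    simp only [h]
    rw [hμ.integral_coord_mul (φ := fun t => yValue p k t ^ 2)
      (h := fun x => walsh p A x * walsh p A x) ((measurable_yValue p k).pow_const 2)
      ((measurable_walsh p A).mul (measurable_walsh p A)) (fun x => by simp [walsh_update hk]),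
      hμ.integral_yValue_sq, ih, one_mul]

/-- The factor `Y k` occurs exactly once, is independent of the rest and has mean zero. -/
lemma integral_walsh_mul_of_mem (hμ : IsRademacherSeq μ coord p) {A B : Finset ℕ} {k : ℕ}
    (hA : k ∈ A) (hB : k ∉ B) : ∫ x, walsh p A x * walsh p B x ∂μ = 0 := by
  have hk : k ∉ A.erase k := Finset.notMem_erase k A
  simp only [walsh_eq_mul_erase hA, mul_assoc]
  rw [hμ.integral_coord_mul (measurable_yValue p k)
    (h := fun x => walsh p (A.erase k) x * walsh p B x)
    ((measurable_walsh p _).mul (measurable_walsh p _))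
    (fun x => by simp [walsh_update hk, walsh_update hB]), hμ.integral_yValue, zero_mul]

lemma integral_walsh_mul (hμ : IsRademacherSeq μ coord p) (A B : Finset ℕ) :
    ∫ x, walsh p A x * walsh p B x ∂μ = if A = B then 1 else 0 := by
  split_ifs with h
  · rw [h, hμ.integral_walsh_mul_self]
  · by_cases hAB : A ⊆ B
    · obtain ⟨k, hkB, hkA⟩ := Finset.not_subset.1 fun hBA => h (hAB.antisymm hBA)
      simp only [mul_comm (walsh p A _)]
      exact hμ.integral_walsh_mul_of_mem hkB hkA
    · obtain ⟨k, hkA, hkB⟩ := Finset.not_subset.1 hAB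
      exact hμ.integral_walsh_mul_of_mem hkA hkB

/-- Two points determine an affine function. Products of such functions over finitely many
coordinates expand into Walsh functions. -/
lemma exists_eq_add_mul_yValue (hμ : IsRademacherSeq μ coord p) (k : ℕ) (φ : ℝ → ℝ) :
    ∃ a b : ℝ, ∀ t, t = 1 ∨ t = -1 → φ t = b * yValue p k t + a := by
  have h2 := (Real.sqrt_pos.2 (hμ.mul_one_sub_pos k)).ne'
  refine ⟨φ 1 - (φ 1 - φ (-1)) * √(p k * (1 - p k)) * yValue p k 1,
    (φ 1 - φ (-1)) * √(p k * (1 - p k)), ?_⟩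
  rintro t (rfl | rfl)
  · ring
  · rw [yValue, yValue]
    field_simp
    ring

lemma integrable_mul_walsh (hμ : IsRademacherSeq μ coord p) {f : (ℕ → ℝ) → ℝ}
    (hf : Integrable f μ) (A : Finset ℕ) : Integrable (fun x => f x * walsh p A x) μ :=
  (memLp_one_iff_integrable.2 hf).integrable_mul (hμ.memLp_top_walsh A)

/-- The Walsh functions are total. -/
lemma ae_eq_zero_of_walshCoef_eq_zero (hμ : IsRademacherSeq μ coord p) {f : (ℕ → ℝ) → ℝ}
    (hf : Integrable f μ) (h0 : ∀ A, walshCoef μ p f A = 0) : f =ᵐ[μ] 0 := by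
  have hcyl : ∀ S ∈ squareCylinders fun _ : ℕ => {s : Set ℝ | MeasurableSet s},
      ∫ x in S, f x ∂μ = 0 := by
    rintro _ ⟨s, t, ht, rfl⟩
    -- Each factor of the cylinder's indicator is affine in `Y k`, so the indicator is a linear
    -- combination of Walsh functions, against which `f` integrates to zero.
    choose a b hab using fun k => hμ.exists_eq_add_mul_yValue k (Set.indicator (t k) 1)
    have hS : MeasurableSet ((s : Set ℕ).pi t) :=
      MeasurableSet.pi s.countable_toSet fun i _ => ht i trivial
    rw [← integral_indicator hS]
    have h1 : Set.indicator ((s : Set ℕ).pi t) f =ᵐ[μ] fun x => ∑ B ∈ s.powerset,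
        ((∏ k ∈ B, b k) * ∏ k ∈ s \ B, a k) * (f x * walsh p B x) := by
      filter_upwards [ae_all_iff.2 hμ.ae_coord] with x hx
      have h2 : ∏ k ∈ s, Set.indicator (t k) (1 : ℝ → ℝ) (x k) =
          Set.indicator ((s : Set ℕ).pi t) 1 x := by
        by_cases hxs : x ∈ (s : Set ℕ).pi t
        · rw [Set.indicator_of_mem hxs]
          exact Finset.prod_eq_one fun k hk => by simp [Set.indicator_of_mem (hxs k hk)]
        · rw [Set.indicator_of_notMem hxs]
          simp only [Set.mem_pi, not_forall] at hxs
          obtain ⟨k, hk, hxk⟩ := hxs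
          exact Finset.prod_eq_zero hk (Set.indicator_of_notMem hxk _)
      have h3 : Set.indicator ((s : Set ℕ).pi t) f x =
          f x * Set.indicator ((s : Set ℕ).pi t) 1 x := by
        by_cases hxs : x ∈ (s : Set ℕ).pi t <;> simp [hxs]
      rw [h3, ← h2, Finset.prod_congr rfl fun k _ => hab k (x k) (hx k), Finset.prod_add,
        Finset.mul_sum]
      refine Finset.sum_congr rfl fun B _ => ?_
      rw [Finset.prod_mul_distrib, walsh]
      simp only [Y_coord]
      ring
    rw [integral_congr_ae h1, integral_finsetSum _
      fun B _ => (hμ.integrable_mul_walsh hf B).const_mul _]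
    refine Finset.sum_eq_zero fun B _ => ?_
    rw [integral_const_mul]
    exact mul_eq_zero_of_right _ (h0 B)
  have huniv : ∫ x, f x ∂μ = 0 := by simpa [walshCoef, walsh] using h0 ∅
  -- Square cylinders form a π-system generating the product σ-algebra.
  have hall : ∀ S, MeasurableSet S → ∫ x in S, f x ∂μ = 0 := by
    intro S hS
    induction S, hS using MeasurableSpace.induction_on_inter
      (generateFrom_squareCylinders (α := fun _ : ℕ => ℝ)).symm
      (isPiSystem_squareCylinders (fun _ => MeasurableSpace.isPiSystem_measurableSet) (by simp)) with
    | empty => simp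
    | basic t ht => exact hcyl t ht
    | compl t ht ih =>
      have := integral_add_compl ht hf
      rw [ih, huniv, zero_add] at this
      exact this
    | iUnion g hd hm ih =>
      rw [integral_iUnion hm hd hf.integrableOn]
      simp [ih]
  exact hf.ae_eq_zero_of_forall_setIntegral_eq_zero fun S hS _ => hall S hS

lemma inner_toLp {f g : (ℕ → ℝ) → ℝ} (hf : MemLp f 2 μ) (hg : MemLp g 2 μ) :
    inner ℝ (hf.toLp f) (hg.toLp g) = ∫ x, f x * g x ∂μ := by
  rw [L2.inner_def]
  refine integral_congr_ae ?_
  filter_upwards [hf.coeFn_toLp, hg.coeFn_toLp] with x h1 h2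
  rw [h1, h2]; simp [mul_comm]

lemma orthonormal_walsh (hμ : IsRademacherSeq μ coord p) :
    Orthonormal ℝ fun A => (hμ.memLp_walsh A).toLp (walsh p A) := by
  classical
  rw [orthonormal_iff_ite]
  intro A B
  rw [inner_toLp, hμ.integral_walsh_mul]

/-- The Walsh functions form a Hilbert basis of `L²`. -/
lemma exists_hilbertBasis_walsh (hμ : IsRademacherSeq μ coord p) :
    ∃ b : HilbertBasis (Finset ℕ) ℝ (Lp ℝ 2 μ),
      ∀ A, b A = (hμ.memLp_walsh A).toLp (walsh p A) := by
  refine ⟨HilbertBasis.mkOfOrthogonalEqBot hμ.orthonormal_walsh ?_, fun A => by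
    rw [HilbertBasis.coe_mkOfOrthogonalEqBot]⟩
  rw [Submodule.eq_bot_iff]
  intro v hv
  have hm := Lp.memLp v
  have h0 : ∀ A, walshCoef μ p v A = 0 := by
    intro A
    have h1 := (Submodule.mem_orthogonal' _ _).1 hv _ (Submodule.subset_span ⟨A, rfl⟩)
    rw [← Lp.toLp_coeFn v hm] at h1
    rwa [inner_toLp] at h1
  have := hμ.ae_eq_zero_of_walshCoef_eq_zero (hm.integrable one_le_two) h0
  exact (Lp.eq_zero_iff_ae_eq_zero).2 this

/-- Parseval's identity for the Walsh functions. -/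
lemma hasSum_walshCoef_mul (hμ : IsRademacherSeq μ coord p) {f g : (ℕ → ℝ) → ℝ}
    (hf : MemLp f 2 μ) (hg : MemLp g 2 μ) :
    HasSum (fun A => walshCoef μ p f A * walshCoef μ p g A) (∫ x, f x * g x ∂μ) := by
  obtain ⟨b, hb⟩ := hμ.exists_hilbertBasis_walsh
  have h := b.hasSum_inner_mul_inner (hf.toLp f) (hg.toLp g)
  rw [inner_toLp] at h
  refine h.congr_fun fun A => ?_
  rw [hb, inner_toLp, inner_toLp, walshCoef, walshCoef]
  simp only [mul_comm (walsh p A _)]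

end IsRademacherSeq
end Rademacher

/-! ### The discrete gradient in Walsh coefficients and integration by parts -/

namespace Rademacher
set_option linter.unusedSectionVars false

/-- The discrete gradient of a function on the sequence space. -/
noncomputable def dgrad (p : ℕ → ℝ) (f : (ℕ → ℝ) → ℝ) (k : ℕ) (x : ℕ → ℝ) : ℝ :=
  √(p k * (1 - p k)) * (f (Function.update x k 1) - f (Function.update x k (-1)))

lemma measurable_dgrad {f : (ℕ → ℝ) → ℝ} (p : ℕ → ℝ) (hf : Measurable f) (k : ℕ) :
    Measurable (dgrad p f k) :=
  ((hf.comp measurable_update_left).sub (hf.comp measurable_update_left)).const_mul _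

lemma dgrad_update (p : ℕ → ℝ) (f : (ℕ → ℝ) → ℝ) (k : ℕ) (x : ℕ → ℝ) (t : ℝ) :
    dgrad p f k (Function.update x k t) = dgrad p f k x := by
  simp [dgrad]

variable {μ : Measure (ℕ → ℝ)} [IsProbabilityMeasure μ] {p : ℕ → ℝ}

namespace IsRademacherSeq

lemma memLp_dgrad (hμ : IsRademacherSeq μ coord p) {f : (ℕ → ℝ) → ℝ} {r : ENNReal}
    (hf : MemLp f r μ) (k : ℕ) : MemLp (dgrad p f k) r μ :=
  ((hμ.memLp_update k (.inl rfl) hf).sub (hμ.memLp_update k (.inr rfl) hf)).const_mul _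

/-- Splitting according to the value of `x k`, the masses times the values of `Y k` are `√(pq)` and
`-√(pq)`, exactly the coefficients of `D_k f`. -/
lemma integral_mul_yValue_mul (hμ : IsRademacherSeq μ coord p) {f h : (ℕ → ℝ) → ℝ} {k : ℕ}
    (hf : MemLp f 2 μ) (hfm : Measurable f) (hh : MemLp h ⊤ μ) (hhm : Measurable h)
    (hk : ∀ x t, h (Function.update x k t) = h x) :
    ∫ x, f x * (yValue p k (x k) * h x) ∂μ = ∫ x, dgrad p f k x * h x ∂μ := by
  have hi : ∀ e : ℝ, (e = 1 ∨ e = -1) →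
      Integrable (fun x => f (Function.update x k e) * h x) μ := fun e he =>
    (memLp_one_iff_integrable.2 ((hμ.memLp_update k he hf).integrable one_le_two)).integrable_mul hh
  have hm : ∀ e : ℝ, Measurable fun x => f (Function.update x k e) * h x := fun e =>
    (hfm.comp measurable_update_left).mul hhm
  have hj : ∀ e : ℝ, (e = 1 ∨ e = -1) → Integrable (fun x : ℕ → ℝ =>
      Set.indicator {e} (1 : ℝ → ℝ) (x k) * (f (Function.update x k e) * h x)) μ := by
    intro e he
    have := (hμ.memLp_top_comp_coord k
      (measurable_one.indicator (measurableSet_singleton e))).integrable_mul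
      (memLp_one_iff_integrable.2 (hi e he))
    exact this
  have hne : (1 : ℝ) ≠ -1 := by norm_num
  have h1 : (fun x => f x * (yValue p k (x k) * h x)) =ᵐ[μ] fun x =>
      yValue p k 1 * (Set.indicator {1} (1 : ℝ → ℝ) (x k) * (f (Function.update x k 1) * h x))
      + yValue p k (-1) *
        (Set.indicator {-1} (1 : ℝ → ℝ) (x k) * (f (Function.update x k (-1)) * h x)) := by
    filter_upwards [hμ.ae_coord k] with x hx
    have hu : Function.update x k (x k) = x := Function.update_eq_self k x
    rcases hx with hx | hx <;> rw [hx] at hu <;> simp [hx, hu, hne, hne.symm] <;> ring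
  have hF : ∀ e : ℝ, ∫ x, Set.indicator {e} (1 : ℝ → ℝ) (x k) *
      (f (Function.update x k e) * h x) ∂μ =
      (∫ x, Set.indicator {e} (1 : ℝ → ℝ) (x k) ∂μ) * ∫ x, f (Function.update x k e) * h x ∂μ :=
    fun e => hμ.integral_coord_mul (measurable_one.indicator (measurableSet_singleton e)) (hm e)
      (fun x => by simp [hk])
  rw [integral_congr_ae h1, integral_add ((hj 1 (.inl rfl)).const_mul _)
    ((hj (-1) (.inr rfl)).const_mul _), integral_const_mul, integral_const_mul, hF, hF,
    hμ.integral_indicator_one, hμ.integral_indicator_neg_one, ← mul_assoc, ← mul_assoc,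
    mul_comm (yValue p k 1), mul_comm (yValue p k (-1)), hμ.yValue_one, hμ.yValue_neg_one]
  simp only [dgrad, mul_assoc]
  rw [integral_const_mul]
  simp only [sub_mul]
  rw [integral_sub (hi 1 (.inl rfl)) (hi (-1) (.inr rfl))]
  ring

/-- Thus `Y_k D_k f` is the projection of `f` onto the Walsh functions containing `k`. The factor `Y
k` keeps the coefficients indexed by `A` instead of `A.erase k`, and costs nothing in `L²` since
`E[Y_k²] = 1`. -/
lemma walshCoef_yValue_mul_dgrad (hμ : IsRademacherSeq μ coord p) {f : (ℕ → ℝ) → ℝ}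
    (hf : MemLp f 2 μ) (hfm : Measurable f) (k : ℕ) (A : Finset ℕ) :
    walshCoef μ p (fun x => yValue p k (x k) * dgrad p f k x) A =
      if k ∈ A then walshCoef μ p f A else 0 := by
  rw [walshCoef]
  split_ifs with hk
  · have hk' : k ∉ A.erase k := Finset.notMem_erase k A
    have h1 : ∀ x, yValue p k (x k) * dgrad p f k x * walsh p A x =
        yValue p k (x k) ^ 2 * (dgrad p f k x * walsh p (A.erase k) x) := by
      intro x
      rw [walsh_eq_mul_erase hk]; ring
    simp only [h1]
    rw [hμ.integral_coord_mul (φ := fun t => yValue p k t ^ 2)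
      (h := fun x => dgrad p f k x * walsh p (A.erase k) x) ((measurable_yValue p k).pow_const 2)
      ((measurable_dgrad p hfm k).mul (measurable_walsh p _))
      (fun x => by simp [walsh_update hk', dgrad_update]), hμ.integral_yValue_sq, one_mul,
      ← hμ.integral_mul_yValue_mul hf hfm (hμ.memLp_top_walsh _) (measurable_walsh p _)
      (walsh_update hk'), walshCoef]
    simp only [walsh_eq_mul_erase hk]
  · simp only [mul_assoc]
    rw [hμ.integral_coord_mul (measurable_yValue p k)
      (h := fun x => dgrad p f k x * walsh p A x)
      ((measurable_dgrad p hfm k).mul (measurable_walsh p _))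
      (fun x => by simp [walsh_update hk, dgrad_update]), hμ.integral_yValue, zero_mul]

lemma integral_yValue_sq_mul (hμ : IsRademacherSeq μ coord p) {k : ℕ} {h : (ℕ → ℝ) → ℝ}
    (hh : Measurable h) (hk : ∀ x t, h (Function.update x k t) = h x) :
    ∫ x, yValue p k (x k) ^ 2 * h x ∂μ = ∫ x, h x ∂μ := by
  rw [hμ.integral_coord_mul (φ := fun t => yValue p k t ^ 2)
    ((measurable_yValue p k).pow_const 2) hh (fun x => hk x 0), hμ.integral_yValue_sq, one_mul]

lemma hasSum_walshCoef_dgrad (hμ : IsRademacherSeq μ coord p) {f g : (ℕ → ℝ) → ℝ}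
    (hf : MemLp f 2 μ) (hfm : Measurable f) (hg : MemLp g 2 μ) (hgm : Measurable g) (k : ℕ) :
    HasSum (fun A => if k ∈ A then walshCoef μ p f A * walshCoef μ p g A else 0)
      (∫ x, dgrad p f k x * dgrad p g k x ∂μ) := by
  have hm : ∀ {f : (ℕ → ℝ) → ℝ}, MemLp f 2 μ →
      MemLp (fun x => yValue p k (x k) * dgrad p f k x) 2 μ := fun hf =>
    (hμ.memLp_dgrad hf k).mul (hμ.memLp_top_comp_coord k (measurable_yValue p k))
  have h := hμ.hasSum_walshCoef_mul (hm hf) (hm hg)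
  have h2 : ∫ x, yValue p k (x k) * dgrad p f k x * (yValue p k (x k) * dgrad p g k x) ∂μ =
      ∫ x, dgrad p f k x * dgrad p g k x ∂μ := by
    rw [← hμ.integral_yValue_sq_mul (k := k) (h := fun x => dgrad p f k x * dgrad p g k x)
      ((measurable_dgrad p hfm k).mul (measurable_dgrad p hgm k))
      (fun x t => by simp [dgrad_update])]
    congr 1; ext x; ring
  rw [h2] at h
  refine h.congr_fun fun A => ?_
  rw [hμ.walshCoef_yValue_mul_dgrad hf hfm, hμ.walshCoef_yValue_mul_dgrad hg hgm]
  split_ifs <;> simp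

/-- The gradient in chaos: `∑ₖ E[D_k f D_k g] = ∑_A |A| f_A g_A`. -/
lemma hasSum_integral_dgrad_mul (hμ : IsRademacherSeq μ coord p) {f g : (ℕ → ℝ) → ℝ}
    (hf : MemLp f 2 μ) (hfm : Measurable f) (hg : MemLp g 2 μ) (hgm : Measurable g)
    (hs : Summable fun A : Finset ℕ => (A.card : ℝ) * (walshCoef μ p f A * walshCoef μ p g A)) :
    HasSum (fun k => ∫ x, dgrad p f k x * dgrad p g k x ∂μ)
      (∑' A : Finset ℕ, (A.card : ℝ) * (walshCoef μ p f A * walshCoef μ p g A)) := by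
  set c : Finset ℕ → ℝ := fun A => walshCoef μ p f A * walshCoef μ p g A with hc
  have hfin : ∀ (d : ℝ) (A : Finset ℕ), HasSum (fun k => if k ∈ A then d else 0)
      ((A.card : ℝ) * d) := by
    intro d A
    have : HasSum (fun k => if k ∈ A then d else 0) (∑ k ∈ A, if k ∈ A then d else 0) :=
      hasSum_sum_of_ne_finset_zero fun k hk => if_neg hk
    simpa using this
  -- Absolute summability over pairs with `k ∈ A` permits both orders of summation: over `k` first
  -- gives `|A|`, over `A` first gives the gradient terms.
  have hsum : Summable fun q : Finset ℕ × ℕ => if q.2 ∈ q.1 then c q.1 else 0 := by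
    refine Summable.of_norm ?_
    refine (summable_prod_of_nonneg fun q => norm_nonneg _).2 ⟨fun A => ?_, ?_⟩
    · refine (hfin |c A| A).summable.congr fun k => ?_
      simp only; split_ifs <;> simp
    · refine hs.norm.congr fun A => ?_
      rw [norm_mul, Real.norm_of_nonneg (Nat.cast_nonneg _), Real.norm_eq_abs,
        ← (hfin |c A| A).tsum_eq]
      refine tsum_congr fun k => ?_
      simp only; split_ifs <;> simp
  obtain ⟨S, hS⟩ := hsum
  have h1 := hS.prod_fiberwise fun A => hfin (c A) A
  have h2 := ((Equiv.prodComm ℕ (Finset ℕ)).hasSum_iff.2 hS).prod_fiberwise fun k =>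
    hμ.hasSum_walshCoef_dgrad hf hfm hg hgm k
  rw [h1.tsum_eq]
  exact h2

/-- If `m = -L⁻¹ f`, in terms of Walsh coefficients, then `∑ₖ E[(D_k m)²] < ∞`. -/
lemma summable_integral_dgrad_sq (hμ : IsRademacherSeq μ coord p) {f m : (ℕ → ℝ) → ℝ}
    (hf : MemLp f 2 μ) (hm : MemLp m 2 μ) (hmm : Measurable m)
    (h : ∀ A : Finset ℕ, A.Nonempty → (A.card : ℝ) * walshCoef μ p m A = walshCoef μ p f A) :
    Summable fun k => ∫ x, dgrad p m k x ^ 2 ∂μ := by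
  have hs : Summable fun A : Finset ℕ =>
      (A.card : ℝ) * (walshCoef μ p m A * walshCoef μ p m A) := by
    have h1 := (hμ.hasSum_walshCoef_mul hf hm).summable
    -- For nonempty `A` the term `|A| m_A²` equals `f_A m_A`, summable by Parseval. At `∅` the
    -- weight `|A|` is zero, so the Parseval term there is replaced by 0.
    refine (h1.update ∅ 0).congr fun A => ?_
    rcases A.eq_empty_or_nonempty with rfl | hA
    · simp
    · rw [Function.update_of_ne hA.ne_empty, ← h A hA]; ring
  simpa only [pow_two] using (hμ.hasSum_integral_dgrad_mul hm hmm hm hmm hs).summable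

/-- Integration by parts: `∑ₖ E[D_k g D_k m] = E[g f]` for `m = -L⁻¹ f`. -/
lemma hasSum_integral_dgrad_mul_of_walshCoef (hμ : IsRademacherSeq μ coord p)
    {f g m : (ℕ → ℝ) → ℝ} (hf : MemLp f 2 μ) (hg : MemLp g 2 μ) (hgm : Measurable g)
    (hm : MemLp m 2 μ) (hmm : Measurable m) (hf0 : ∫ x, f x ∂μ = 0)
    (h : ∀ A : Finset ℕ, A.Nonempty → (A.card : ℝ) * walshCoef μ p m A = walshCoef μ p f A) :
    HasSum (fun k => ∫ x, dgrad p g k x * dgrad p m k x ∂μ) (∫ x, g x * f x ∂μ) := by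
  have h1 : ∀ A : Finset ℕ, walshCoef μ p g A * walshCoef μ p f A =
      (A.card : ℝ) * (walshCoef μ p g A * walshCoef μ p m A) := by
    intro A
    rcases A.eq_empty_or_nonempty with rfl | hA
    -- The empty set carries no gradient; centring of `f` removes its contribution to `E[g f]`.
    · have : walshCoef μ p f ∅ = 0 := by simpa [walshCoef, walsh] using hf0
      simp [this]
    · rw [← h A hA]; ring
  have h2 := hμ.hasSum_walshCoef_mul hg hf
  simp only [h1] at h2
  rw [← h2.tsum_eq]
  exact hμ.hasSum_integral_dgrad_mul hg hgm hm hmm h2.summable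

end IsRademacherSeq
end Rademacher

namespace Rademacher
set_option linter.unusedSectionVars false

/-! ### Sums in `L²` -/

section L2Sum

variable {α ι : Type*} [MeasurableSpace α] {P : Measure α} {u v : ι → α → ℝ} {S S' : α → ℝ}

lemma sum_toLp (hu : ∀ i, MemLp (u i) 2 P) (A : Finset ι) :
    ⇑(∑ i ∈ A, (hu i).toLp (u i)) =ᵐ[P] fun x => ∑ i ∈ A, u i x := by
  have h : ∀ᵐ x ∂P, ∀ i ∈ A, (hu i).toLp (u i) x = u i x :=
    (ae_ball_iff A.countable_toSet).2 fun i _ => (hu i).coeFn_toLp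
  filter_upwards [Lp.coeFn_finsetSum A fun i => (hu i).toLp (u i), h] with x h1 h2
  rw [h1, Finset.sum_apply]
  exact Finset.sum_congr rfl h2

/-- In the Hilbert space `Lp`, limits are unique and continuous functionals such as Walsh
coefficients pass through sums. -/
lemma isL2Sum_iff_hasSum (hu : ∀ i, MemLp (u i) 2 P) (hS : MemLp S 2 P) :
    IsL2Sum P u S ↔ HasSum (fun i => (hu i).toLp (u i)) (hS.toLp S) := by
  rw [IsL2Sum, HasSum, SummationFilter.unconditional_filter, Lp.tendsto_Lp_iff_tendsto_eLpNorm']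
  simp only [hS, true_and]
  refine tendsto_congr fun A => eLpNorm_congr_ae ?_
  filter_upwards [sum_toLp hu A, hS.coeFn_toLp] with x h1 h2
  rw [Pi.sub_apply, h1, h2]

lemma exists_isL2Sum (hu : ∀ i, MemLp (u i) 2 P)
    (h : Summable fun i => (hu i).toLp (u i)) : ∃ S, IsL2Sum P u S := by
  obtain ⟨S, hS⟩ := h
  refine ⟨S, (isL2Sum_iff_hasSum hu (Lp.memLp S)).2 ?_⟩
  rwa [Lp.toLp_coeFn]

lemma IsL2Sum.l2Sum (h : IsL2Sum P u S) : IsL2Sum P u (L2Sum P u) := by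
  have h' : ∃ S, IsL2Sum P u S := ⟨S, h⟩
  rw [L2Sum, dif_pos h']
  exact h'.choose_spec

lemma IsL2Sum.ae_eq (hu : ∀ i, MemLp (u i) 2 P) (h : IsL2Sum P u S) (h' : IsL2Sum P u S') :
    S =ᵐ[P] S' :=
  (MemLp.toLp_eq_toLp_iff h.1 h'.1).1
    (((isL2Sum_iff_hasSum hu h.1).1 h).unique ((isL2Sum_iff_hasSum hu h'.1).1 h'))

lemma IsL2Sum.congr (h : IsL2Sum P u S) (hu : ∀ i, u i =ᵐ[P] v i) (hS : S =ᵐ[P] S') :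
    IsL2Sum P v S' := by
  refine ⟨h.1.ae_eq hS, (tendsto_congr fun A => eLpNorm_congr_ae ?_).1 h.2⟩
  filter_upwards [(ae_ball_iff A.countable_toSet).2 fun i _ => hu i, hS] with x h1 h2
  rw [h2, Finset.sum_congr rfl h1]

lemma isL2Sum_comp_iff {β : Type*} [MeasurableSpace β] {ν : Measure β} {T : α → β}
    (hT : MeasurePreserving T P ν) {u : ι → β → ℝ} {S : β → ℝ}
    (hu : ∀ i, AEStronglyMeasurable (u i) ν) (hS : AEStronglyMeasurable S ν) :
    IsL2Sum P (fun i ω => u i (T ω)) (fun ω => S (T ω)) ↔ IsL2Sum ν u S := by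
  rw [IsL2Sum, IsL2Sum]
  refine and_congr ?_ (tendsto_congr fun A => ?_)
  · have := hT.map_eq
    subst this
    exact (memLp_map_measure_iff hS hT.aemeasurable).symm
  · exact eLpNorm_comp_measurePreserving (g := fun x => (∑ i ∈ A, u i x) - S x)
      ((Finset.aestronglyMeasurable_fun_sum A fun i _ => hu i).sub hS) hT

end L2Sum

/-! ### Summability in Hilbert spaces -/

section Hilbert

variable {ι κ H : Type*} [NormedAddCommGroup H] [InnerProductSpace ℝ H] [CompleteSpace H]

/-- A series over an orthonormal family with bounded repetition converges if its coefficients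
are square summable. -/
lemma summable_smul_orthonormal_comp {w : κ → H} (hw : Orthonormal ℝ w) [DecidableEq κ]
    {c : ι → ℝ} (hc : Summable fun i => c i ^ 2) {key : ι → κ} {N : ℕ}
    (hN : ∀ (t : Finset ι) (b : κ), (t.filter fun j => key j = b).card ≤ N) :
    Summable fun i => c i • w (key i) := by
  have hbound : ∀ t : Finset ι, ‖∑ i ∈ t, c i • w (key i)‖ ^ 2 ≤ N * ∑ i ∈ t, c i ^ 2 := by
    intro t
    have h1 : ‖∑ i ∈ t, c i • w (key i)‖ ^ 2 =
        ∑ i ∈ t, ∑ j ∈ t, if key j = key i then c i * c j else 0 := by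
      rw [← real_inner_self_eq_norm_sq, sum_inner]
      refine Finset.sum_congr rfl fun i _ => ?_
      rw [inner_sum]
      refine Finset.sum_congr rfl fun j _ => ?_
      rw [real_inner_smul_left, real_inner_smul_right, orthonormal_iff_ite.1 hw]
      simp only [eq_comm (a := key j)]
      split_ifs <;> simp
    have h2 : ∑ i ∈ t, ∑ j ∈ t, (if key j = key i then c i ^ 2 else 0) ≤ N * ∑ i ∈ t, c i ^ 2 := by
      rw [Finset.mul_sum]
      refine Finset.sum_le_sum fun i _ => ?_
      rw [← Finset.sum_filter, Finset.sum_const, nsmul_eq_mul]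
      exact mul_le_mul_of_nonneg_right (by exact_mod_cast hN t (key i)) (sq_nonneg _)
    have h3 : ∑ i ∈ t, ∑ j ∈ t, (if key j = key i then c j ^ 2 else 0) =
        ∑ i ∈ t, ∑ j ∈ t, (if key j = key i then c i ^ 2 else 0) := by
      rw [Finset.sum_comm]
      simp only [eq_comm]
    -- Here `c i * c j` is replaced by the mean of the squares; each index shares its key with at
    -- most `N` indices of `t`, itself included.
    have h4 : ∑ i ∈ t, ∑ j ∈ t, (if key j = key i then c i * c j else 0) ≤
        ∑ i ∈ t, ∑ j ∈ t, ((if key j = key i then c i ^ 2 else 0) +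
          (if key j = key i then c j ^ 2 else 0)) / 2 := by
      refine Finset.sum_le_sum fun i _ => Finset.sum_le_sum fun j _ => ?_
      split_ifs
      · nlinarith [sq_nonneg (c i - c j)]
      · simp
    simp only [← Finset.sum_div, Finset.sum_add_distrib, h3] at h4
    linarith
  rw [summable_iff_vanishing_norm] at hc ⊢
  intro ε hε
  obtain ⟨s, hs⟩ := hc (ε ^ 2 / (N + 1)) (by positivity)
  refine ⟨s, fun t ht => ?_⟩
  have h1 := hs t ht
  rw [Real.norm_of_nonneg (Finset.sum_nonneg fun i _ => sq_nonneg _),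
    lt_div_iff₀ (by positivity)] at h1
  have h2 := hbound t
  have h3 : 0 ≤ ∑ i ∈ t, c i ^ 2 := Finset.sum_nonneg fun i _ => sq_nonneg _
  refine lt_of_pow_lt_pow_left₀ 2 hε.le ?_
  nlinarith

lemma summable_comp_of_card_le [DecidableEq κ] {d : κ → ℝ} (hd : Summable d) (h0 : ∀ b, 0 ≤ d b)
    {key : ι → κ} {N : ℕ}
    (hN : ∀ (t : Finset ι) (b : κ), (t.filter fun j => key j = b).card ≤ N) :
    Summable fun i => d (key i) := by
  refine summable_of_sum_le (c := N * ∑' b, d b) (fun i => h0 _) fun t => ?_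
  rw [Finset.sum_comp d key]
  calc _ ≤ ∑ b ∈ t.image key, (N : ℝ) * d b := by
        refine Finset.sum_le_sum fun b _ => ?_
        rw [nsmul_eq_mul]
        exact mul_le_mul_of_nonneg_right (by exact_mod_cast hN t b) (h0 b)
    _ = N * ∑ b ∈ t.image key, d b := by rw [Finset.mul_sum]
    _ ≤ _ := mul_le_mul_of_nonneg_left (hd.sum_le_tsum _ fun b _ => h0 b) (Nat.cast_nonneg _)

/-- By Pythagoras, multipliers of modulus at most 1 can only shrink the norms of finite partial
sums. Used for the factors `-1/n` in `L⁻¹`. -/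
lemma summable_smul_of_orthogonal {v : ι → H} (hv : Summable v)
    (ho : ∀ i j, i ≠ j → inner ℝ (v i) (v j) = 0) {a : ι → ℝ} (ha : ∀ i, |a i| ≤ 1) :
    Summable fun i => a i • v i := by
  classical
  have hnorm : ∀ (b : ι → ℝ) (t : Finset ι), ‖∑ i ∈ t, b i • v i‖ ^ 2 =
      ∑ i ∈ t, b i ^ 2 * ‖v i‖ ^ 2 := by
    intro b t
    rw [← real_inner_self_eq_norm_sq, sum_inner]
    refine Finset.sum_congr rfl fun i hi => ?_
    rw [inner_sum, Finset.sum_eq_single_of_mem i hi]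
    · rw [real_inner_smul_left, real_inner_smul_right, real_inner_self_eq_norm_sq]; ring
    · intro j _ hj
      rw [real_inner_smul_left, real_inner_smul_right, ho i j hj.symm]; ring
  rw [summable_iff_vanishing_norm] at hv ⊢
  intro ε hε
  obtain ⟨s, hs⟩ := hv ε hε
  refine ⟨s, fun t ht => lt_of_le_of_lt ?_ (hs t ht)⟩
  refine le_of_sq_le_sq ?_ (norm_nonneg _)
  have h1 := hnorm (fun _ => 1) t
  simp only [one_smul, one_pow, one_mul] at h1
  rw [hnorm, h1]
  refine Finset.sum_le_sum fun i _ => mul_le_of_le_one_left (sq_nonneg _) ?_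
  rw [← sq_abs]
  exact pow_le_one₀ (abs_nonneg _) (ha i)

end Hilbert

/-! ### Multiple integrals on the sequence space -/

variable {μ : Measure (ℕ → ℝ)} [IsProbabilityMeasure μ] {p : ℕ → ℝ}

/-- The summands of the discrete multiple integral, as multiples of Walsh functions. -/
lemma multipleIntegral_summand_eq (p : ℕ → ℝ) {n : ℕ} (f : (Fin n → ℕ) → ℝ) (i : Fin n → ℕ) :
    (fun x => Set.indicator {i : Fin n → ℕ | Function.Injective i} f i * ∏ j, Y coord p (i j) x) =
      fun x => Set.indicator {i : Fin n → ℕ | Function.Injective i} f i *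
        walsh p (Finset.univ.image i) x := by
  ext x
  by_cases hi : i ∈ {i : Fin n → ℕ | Function.Injective i}
  · have hinj : Function.Injective i := hi
    rw [walsh, Finset.prod_image (hinj.injOn)]
  · rw [Set.indicator_of_notMem hi, zero_mul, zero_mul]

/-- All entries of such a tuple lie in `B`, which has at most `n` elements. The crude `n ^ n`
suffices as a bound on how often a Walsh function is repeated in `J_n`. -/
lemma card_filter_image_eq_le {n : ℕ} (t : Finset (Fin n → ℕ)) (B : Finset ℕ) :
    (t.filter fun j => Finset.univ.image j = B).card ≤ n ^ n := by
  rcases (t.filter fun j => Finset.univ.image j = B).eq_empty_or_nonempty with h | ⟨j, hj⟩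
  · simp [h]
  · have hB : B.card ≤ n := by
      rw [← (Finset.mem_filter.1 hj).2]
      exact Finset.card_image_le.trans (by simp)
    calc _ ≤ (Fintype.piFinset fun _ : Fin n => B).card := by
          refine Finset.card_le_card fun i hi => ?_
          rw [Fintype.mem_piFinset]
          intro a
          rw [← (Finset.mem_filter.1 hi).2]
          exact Finset.mem_image_of_mem i (Finset.mem_univ a)
      _ = B.card ^ n := by simp
      _ ≤ n ^ n := Nat.pow_le_pow_left hB n

namespace IsRademacherSeq

lemma hasSum_walshCoef_of_isL2Sum (hμ : IsRademacherSeq μ coord p) {ι : Type*}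
    {u : ι → (ℕ → ℝ) → ℝ} {S : (ℕ → ℝ) → ℝ} (hu : ∀ i, MemLp (u i) 2 μ) (h : IsL2Sum μ u S)
    (A : Finset ℕ) : HasSum (fun i => walshCoef μ p (u i) A) (walshCoef μ p S A) := by
  have h1 := ((isL2Sum_iff_hasSum hu h.1).1 h).mapL
    (innerSL ℝ ((hμ.memLp_walsh A).toLp (walsh p A)))
  simp only [innerSL_apply_apply, inner_toLp] at h1
  simpa only [walshCoef, mul_comm (walsh p A _)] using h1

lemma memLp_multipleIntegral_summand (hμ : IsRademacherSeq μ coord p) {n : ℕ}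
    (f : (Fin n → ℕ) → ℝ) (i : Fin n → ℕ) :
    MemLp (fun x => Set.indicator {i : Fin n → ℕ | Function.Injective i} f i *
      ∏ j, Y coord p (i j) x) 2 μ := by
  rw [multipleIntegral_summand_eq]
  exact (hμ.memLp_walsh _).const_mul _

lemma isL2Sum_J (hμ : IsRademacherSeq μ coord p) {n : ℕ} {f : (Fin n → ℕ) → ℝ}
    (hf : Summable fun i => f i ^ 2) :
    IsL2Sum μ (fun (i : Fin n → ℕ) x => Set.indicator {i : Fin n → ℕ | Function.Injective i} f i *
      ∏ j, Y coord p (i j) x) (J μ coord p n f) := by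
  obtain ⟨S, hS⟩ := exists_isL2Sum (hμ.memLp_multipleIntegral_summand f) (by
    have hc : Summable fun i =>
        Set.indicator {i : Fin n → ℕ | Function.Injective i} f i ^ 2 := by
      refine hf.of_nonneg_of_le (fun i => sq_nonneg _) fun i => ?_
      by_cases hi : i ∈ {i : Fin n → ℕ | Function.Injective i}
      · rw [Set.indicator_of_mem hi]
      · rw [Set.indicator_of_notMem hi]; simp [sq_nonneg]
    refine (summable_smul_orthonormal_comp hμ.orthonormal_walsh hc
      (key := fun i => Finset.univ.image i) card_filter_image_eq_le).congr fun i => ?_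
    rw [← MemLp.toLp_const_smul]
    exact MemLp.toLp_congr _ _ (ae_of_all _ fun x =>
      (congrFun (multipleIntegral_summand_eq p f i) x).symm))
  exact hS.l2Sum

lemma walshCoef_J (hμ : IsRademacherSeq μ coord p) {n : ℕ} {f : (Fin n → ℕ) → ℝ}
    (hf : Summable fun i => f i ^ 2) (A : Finset ℕ) :
    walshCoef μ p (J μ coord p n f) A =
      ∑ i ∈ (Fintype.piFinset fun _ : Fin n => A) with
        Function.Injective i ∧ Finset.univ.image i = A, f i := by
  have h := hμ.hasSum_walshCoef_of_isL2Sum (hμ.memLp_multipleIntegral_summand f)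
    (hμ.isL2Sum_J hf) A
  have hterm : ∀ i : Fin n → ℕ, walshCoef μ p (fun x =>
      Set.indicator {i : Fin n → ℕ | Function.Injective i} f i * ∏ j, Y coord p (i j) x) A =
      if Function.Injective i ∧ Finset.univ.image i = A then f i else 0 := by
    intro i
    rw [multipleIntegral_summand_eq, walshCoef]
    simp only [mul_assoc]
    rw [integral_const_mul, hμ.integral_walsh_mul]
    by_cases hi : Function.Injective i
    · simp [hi]
    · simp [hi]
  simp only [hterm] at h
  have hzero : ∀ i ∉ (Fintype.piFinset fun _ : Fin n => A),
      (if Function.Injective i ∧ Finset.univ.image i = A then f i else 0) = 0 := by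
    intro i hi
    refine if_neg fun h' => hi ?_
    rw [Fintype.mem_piFinset, ← h'.2]
    exact fun a => Finset.mem_image_of_mem i (Finset.mem_univ a)
  rw [h.unique (hasSum_sum_of_ne_finset_zero hzero), Finset.sum_filter]

lemma walshCoef_J_of_card_ne (hμ : IsRademacherSeq μ coord p) {n : ℕ} {f : (Fin n → ℕ) → ℝ}
    (hf : Summable fun i => f i ^ 2) {A : Finset ℕ} (hA : A.card ≠ n) :
    walshCoef μ p (J μ coord p n f) A = 0 := by
  rw [hμ.walshCoef_J hf]
  refine Finset.sum_eq_zero fun i hi => absurd ?_ hA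
  have h := (Finset.mem_filter.1 hi).2
  rw [← h.2, Finset.card_image_of_injective _ h.1, Finset.card_univ, Fintype.card_fin]

end IsRademacherSeq

/-! ### The chaos expansion and `L⁻¹` on the sequence space -/

open Classical in
/-- The kernels `f_n(i₁, …, iₙ) = E[F Y_{i₁} ⋯ Y_{iₙ}] / n!` of the chaos expansion; the factorial
appears as the number of enumerations of `{i₁, …, iₙ}`. -/
noncomputable def chaosKernel (μ : Measure (ℕ → ℝ)) (p : ℕ → ℝ) (f : (ℕ → ℝ) → ℝ) (n : ℕ)
    (i : Fin n → ℕ) : ℝ :=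
  if Function.Injective i then walshCoef μ p f (Finset.univ.image i) /
    ({j ∈ Fintype.piFinset fun _ : Fin n => Finset.univ.image i | Function.Injective j ∧
      Finset.univ.image j = Finset.univ.image i} : Finset _).card else 0

namespace IsRademacherSeq

lemma summable_chaosKernel_sq (hμ : IsRademacherSeq μ coord p) {f : (ℕ → ℝ) → ℝ}
    (hf : MemLp f 2 μ) (n : ℕ) : Summable fun i => chaosKernel μ p f n i ^ 2 := by
  have h := (hμ.hasSum_walshCoef_mul hf hf).summable
  refine (summable_comp_of_card_le h (fun A => mul_self_nonneg _)
    (key := fun i : Fin n → ℕ => Finset.univ.image i) card_filter_image_eq_le).of_nonneg_of_le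
    (fun i => sq_nonneg _) fun i => ?_
  rw [chaosKernel]
  split_ifs
  · rw [div_pow, ← pow_two]
    -- A vanishing count need not be excluded here: division by zero yields 0.
    rcases Nat.eq_zero_or_pos (({j ∈ Fintype.piFinset fun _ : Fin n => Finset.univ.image i |
      Function.Injective j ∧ Finset.univ.image j = Finset.univ.image i} : Finset _).card)
      with h0 | h0
    · rw [h0]; simp [sq_nonneg]
    · exact div_le_self (sq_nonneg _) (one_le_pow₀ (by exact_mod_cast h0))
  · simpa using mul_self_nonneg _

lemma isKernel_chaosKernel (hμ : IsRademacherSeq μ coord p) {f : (ℕ → ℝ) → ℝ}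
    (hf : MemLp f 2 μ) (n : ℕ) : IsKernel n (chaosKernel μ p f n) where
  summable_sq := hμ.summable_chaosKernel_sq hf n
  symm σ i := by
    have h1 : Function.Injective (i ∘ σ) ↔ Function.Injective i :=
      Function.Injective.of_comp_iff' i σ.bijective
    have h2 : Finset.univ.image (i ∘ σ) = Finset.univ.image i := by
      rw [← Finset.image_image, Finset.image_univ_equiv]
    simp only [chaosKernel, h1, h2]
  diag i hi := if_neg hi

/-- Every enumeration of `A` contributes the same value, and the kernel was divided by their number.
That number is nonzero because the increasing enumeration is one of them. -/
lemma walshCoef_J_chaosKernel (hμ : IsRademacherSeq μ coord p) {f : (ℕ → ℝ) → ℝ}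
    (hf : MemLp f 2 μ) (A : Finset ℕ) :
    walshCoef μ p (J μ coord p A.card (chaosKernel μ p f A.card)) A = walshCoef μ p f A := by
  rw [hμ.walshCoef_J (hμ.summable_chaosKernel_sq hf _)]
  rw [Finset.sum_congr rfl (g := fun _ => walshCoef μ p f A /
    ({j ∈ Fintype.piFinset fun _ : Fin A.card => A | Function.Injective j ∧
      Finset.univ.image j = A} : Finset _).card)]
  · rw [Finset.sum_const, nsmul_eq_mul, mul_div_cancel₀]
    rw [Nat.cast_ne_zero, Finset.card_ne_zero]
    have himg : Finset.univ.image (A.orderEmbOfFin rfl) = A := by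
      rw [← Finset.coe_inj]; simp
    refine ⟨A.orderEmbOfFin rfl, Finset.mem_filter.2 ⟨?_, ?_, himg⟩⟩
    · rw [Fintype.mem_piFinset]
      exact fun a => Finset.orderEmbOfFin_mem A rfl a
    · exact (A.orderEmbOfFin rfl).injective
  · intro i hi
    have h := (Finset.mem_filter.1 hi).2
    rw [chaosKernel, if_pos h.1]
    simp only [h.2]

lemma walshCoef_sub_const (hμ : IsRademacherSeq μ coord p) {f : (ℕ → ℝ) → ℝ}
    (hf : MemLp f 2 μ) (A : Finset ℕ) :
    walshCoef μ p (fun x => f x - ∫ y, f y ∂μ) A = if A = ∅ then 0 else walshCoef μ p f A := by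
  have hfi := hf.integrable one_le_two
  have hW := (hμ.memLp_walsh A).integrable one_le_two
  rw [walshCoef]
  simp only [sub_mul]
  rw [integral_sub (hμ.integrable_mul_walsh hfi A) (hW.const_mul _), integral_const_mul]
  have h := hμ.integral_walsh_mul ∅ A
  simp only [walsh, Finset.prod_empty, one_mul, eq_comm (a := ∅)] at h
  simp only [walsh, h]
  split_ifs with hA
  · subst hA; simp
  · simp [walshCoef, walsh]

/-- Every square-integrable function on the sequence space has a chaos expansion. -/
lemma isChaosExpansion_chaosKernel (hμ : IsRademacherSeq μ coord p) {f : (ℕ → ℝ) → ℝ}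
    (hf : MemLp f 2 μ) : IsChaosExpansion μ coord p f fun n => chaosKernel μ p f n := by
  refine ⟨fun n => hμ.isKernel_chaosKernel hf n, ?_⟩
  have hJ : ∀ n, MemLp (J μ coord p n (chaosKernel μ p f n)) 2 μ := fun n =>
    (hμ.isL2Sum_J (hμ.summable_chaosKernel_sq hf n)).1
  have hF : MemLp (fun x => f x - ∫ y, f y ∂μ) 2 μ := hf.sub (memLp_const _)
  rw [isL2Sum_iff_hasSum (fun n : ℕ+ => hJ n) hF]
  obtain ⟨b, hb⟩ := hμ.exists_hilbertBasis_walsh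
  have hrepr : ∀ {g : (ℕ → ℝ) → ℝ} (hg : MemLp g 2 μ),
      HasSum (fun A => walshCoef μ p g A • b A) (hg.toLp g) := by
    intro g hg
    refine (b.hasSum_repr (hg.toLp g)).congr_fun fun A => ?_
    rw [b.repr_apply_apply, hb, inner_toLp, walshCoef]
    simp only [mul_comm (walsh p A _)]
  have h0 : (fun A => walshCoef μ p (fun x => f x - ∫ y, f y ∂μ) A • b A) =
      fun A => (if A = ∅ then 0 else walshCoef μ p f A) • b A := by
    ext1 A; rw [hμ.walshCoef_sub_const hf]
  have h1 := hrepr hF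
  rw [h0] at h1
  -- The Walsh expansion is grouped by cardinality: level `n` is the expansion of `J_n`, and level 0
  -- vanishes because the mean was subtracted.
  have h2 : HasSum (fun n : ℕ => if n = 0 then 0 else
      (hJ n).toLp (J μ coord p n (chaosKernel μ p f n))) (hF.toLp _) := by
    refine ((Equiv.sigmaFiberEquiv (Finset.card (α := ℕ))).hasSum_iff.2 h1).sigma fun n => ?_
    rcases Nat.eq_zero_or_pos n with rfl | hn
    · rw [if_pos rfl]
      refine hasSum_zero.congr_fun fun A => ?_
      have := Finset.card_eq_zero.1 A.2
      simp [Equiv.sigmaFiberEquiv, this]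
    · rw [if_neg hn.ne']
      have h3 := hrepr (hJ n)
      rw [← hasSum_subtype_iff_of_support_subset (s := {A : Finset ℕ | A.card = n})] at h3
      · refine h3.congr_fun fun A => ?_
        have hA : A.1.card = n := A.2
        have hne : A.1 ≠ ∅ := fun h => by rw [h] at hA; simp at hA; omega
        have h4 := hμ.walshCoef_J_chaosKernel hf A.1
        rw [hA] at h4
        simp [Equiv.sigmaFiberEquiv, hne, h4]
      · intro A hA
        by_contra hne
        exact hA (by simp only [hμ.walshCoef_J_of_card_ne (hμ.summable_chaosKernel_sq hf n)
          (A := A) hne, zero_smul])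
  rw [← PNat.coe_injective.hasSum_iff] at h2
  · refine h2.congr_fun fun n => ?_
    simp
  · intro n hn
    refine if_pos ?_
    by_contra h
    exact hn ⟨⟨n, Nat.pos_of_ne_zero h⟩, rfl⟩

/-- Any chaos expansion computes `L⁻¹`, in terms of Walsh coefficients. -/
lemma exists_isL2Sum_invL (hμ : IsRademacherSeq μ coord p) {f : (ℕ → ℝ) → ℝ}
    (hf : MemLp f 2 μ) {g : (n : ℕ+) → (Fin n → ℕ) → ℝ} (hg : IsChaosExpansion μ coord p f g) :
    ∃ S, IsL2Sum μ (fun (n : ℕ+) x => -(1 / (n : ℝ)) * J μ coord p n (g n) x) S ∧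
      ∀ A : Finset ℕ, A.Nonempty →
        (A.card : ℝ) * walshCoef μ p S A = -walshCoef μ p f A := by
  have hJ : ∀ n : ℕ+, MemLp (J μ coord p n (g n)) 2 μ := fun n =>
    (hμ.isL2Sum_J (hg.1 n).summable_sq).1
  have hJc : ∀ n : ℕ+, MemLp (fun x => -(1 / (n : ℝ)) * J μ coord p n (g n) x) 2 μ := fun n =>
    (hJ n).const_mul _
  -- Multiple integrals of different orders have Walsh coefficients supported on sets of different
  -- cardinality.
  have horth : ∀ n m : ℕ+, n ≠ m →
      inner ℝ ((hJ n).toLp (J μ coord p n (g n))) ((hJ m).toLp (J μ coord p m (g m))) = 0 := by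
    intro n m hnm
    rw [inner_toLp, ← (hμ.hasSum_walshCoef_mul (hJ n) (hJ m)).tsum_eq]
    refine (tsum_congr fun A => ?_).trans tsum_zero
    by_cases hA : A.card = n
    · rw [hμ.walshCoef_J_of_card_ne (hg.1 m).summable_sq (A := A), mul_zero]
      rw [hA]
      exact fun h => hnm (PNat.coe_injective h)
    · rw [hμ.walshCoef_J_of_card_ne (hg.1 n).summable_sq hA, zero_mul]
  have hsum := summable_smul_of_orthogonal ((isL2Sum_iff_hasSum hJ hg.2.1).1 hg.2).summable horth
    (a := fun n : ℕ+ => -(1 / (n : ℝ))) (fun n => by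
      rw [abs_neg, abs_of_nonneg (by positivity)]
      exact div_le_one_of_le₀ (by exact_mod_cast one_le (a := n)) (Nat.cast_nonneg _))
  obtain ⟨S, hS⟩ := exists_isL2Sum hJc (hsum.congr fun n => by
    rw [← MemLp.toLp_const_smul]; rfl)
  refine ⟨S, hS, fun A hA => ?_⟩
  have h1 := hμ.hasSum_walshCoef_of_isL2Sum hJc hS A
  have h2 := hμ.hasSum_walshCoef_of_isL2Sum hJ hg.2 A
  rw [hμ.walshCoef_sub_const hf, if_neg hA.ne_empty] at h2
  have hcoef : ∀ n : ℕ+, walshCoef μ p (fun x => -(1 / (n : ℝ)) * J μ coord p n (g n) x) A =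
      -(1 / (n : ℝ)) * walshCoef μ p (J μ coord p n (g n)) A := by
    intro n
    simp only [walshCoef, mul_assoc]
    rw [integral_const_mul]
  -- Only `n = |A|` contributes, and there the factor `|A|` cancels `1/n`. Since only coefficients
  -- enter, uniqueness of the kernels is not needed.
  have h3 : HasSum (fun n : ℕ+ => walshCoef μ p (J μ coord p n (g n)) A)
      (-((A.card : ℝ) * walshCoef μ p S A)) := by
    refine (h1.mul_left (A.card : ℝ)).neg.congr_fun fun n => ?_
    rw [hcoef]
    by_cases hn : A.card = n
    · rw [hn]
      have : ((n : ℕ) : ℝ) ≠ 0 := by exact_mod_cast n.ne_zero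
      field_simp
    · rw [hμ.walshCoef_J_of_card_ne (hg.1 n).summable_sq hn]; simp
  linarith [h2.unique h3]

end IsRademacherSeq
end Rademacher

namespace Rademacher
set_option linter.unusedSectionVars false

/-! ### Series of integrable functions -/

section Series

variable {α ι : Type*} [Countable ι] [MeasurableSpace α] {P : Measure α} {u : ι → α → ℝ}

lemma tsum_lintegral_enorm_ne_top (hi : ∀ k, Integrable (u k) P)
    (hs : Summable fun k => ∫ x, ‖u k x‖ ∂P) : ∑' k, ∫⁻ x, ‖u k x‖ₑ ∂P ≠ ⊤ := by
  simp only [← ofReal_integral_norm_eq_lintegral_enorm (hi _)]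
  exact hs.tsum_ofReal_ne_top

lemma ae_summable_of_summable_integral_norm (hi : ∀ k, Integrable (u k) P)
    (hs : Summable fun k => ∫ x, ‖u k x‖ ∂P) : ∀ᵐ x ∂P, Summable fun k => u k x := by
  have h := summable_norm_of_tsum_eLpNorm_ne_top le_rfl (fun k => (hi k).1) (by
    simpa only [eLpNorm_one_eq_lintegral_enorm] using tsum_lintegral_enorm_ne_top hi hs)
  filter_upwards [h] with x hx using hx.of_norm

lemma integrable_tsum_of_summable_integral_norm (hi : ∀ k, Integrable (u k) P)
    (hs : Summable fun k => ∫ x, ‖u k x‖ ∂P) : Integrable (fun x => ∑' k, u k x) P := by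
  refine ⟨?_, ?_⟩
  · refine aestronglyMeasurable_of_tendsto_ae (atTop : Filter (Finset ι))
      (f := fun A x => ∑ k ∈ A, u k x)
      (fun A => Finset.aestronglyMeasurable_fun_sum A fun k _ => (hi k).1) ?_
    filter_upwards [ae_summable_of_summable_integral_norm hi hs] with x hx using hx.hasSum
  · calc ∫⁻ x, ‖∑' k, u k x‖ₑ ∂P ≤ ∫⁻ x, ∑' k, ‖u k x‖ₑ ∂P :=
          lintegral_mono fun x => enorm_tsum_le_tsum_enorm
      _ = ∑' k, ∫⁻ x, ‖u k x‖ₑ ∂P := lintegral_tsum fun k => (hi k).1.enorm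
      _ < ⊤ := (tsum_lintegral_enorm_ne_top hi hs).lt_top

end Series

variable {μ : Measure (ℕ → ℝ)} [IsProbabilityMeasure μ] {p : ℕ → ℝ}

/-! ### The bound on the sequence space -/

/-- The weight `(1 + Y k ^ 2) / 2`. -/
noncomputable def weight (p : ℕ → ℝ) (k : ℕ) (t : ℝ) : ℝ := (1 + yValue p k t ^ 2) / 2

lemma measurable_weight (p : ℕ → ℝ) (k : ℕ) : Measurable (weight p k) :=
  (((measurable_yValue p k).pow_const 2).const_add 1).div_const 2

lemma weight_nonneg (p : ℕ → ℝ) (k : ℕ) (t : ℝ) : 0 ≤ weight p k t := by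
  unfold weight; positivity

/-- The remainder term on the sequence space. -/
noncomputable def remainder (p : ℕ → ℝ) (f m : (ℕ → ℝ) → ℝ) (z : ℝ) (k : ℕ) (x : ℕ → ℝ) : ℝ :=
  dgrad p (fun y => steinMono z (f y)) k x * (dgrad p f k x / √(p k * (1 - p k)))
    * |dgrad p m k x|

lemma remainder_update (p : ℕ → ℝ) (f m : (ℕ → ℝ) → ℝ) (z : ℝ) (k : ℕ) (x : ℕ → ℝ) (t : ℝ) :
    remainder p f m z k (Function.update x k t) = remainder p f m z k x := by
  simp [remainder, dgrad_update]

lemma measurable_remainder {f m : (ℕ → ℝ) → ℝ} (p : ℕ → ℝ) (hf : Measurable f)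
    (hm : Measurable m) (z : ℝ) (k : ℕ) : Measurable (remainder p f m z k) :=
  ((measurable_dgrad p ((measurable_steinMono z).comp hf) k).mul
    ((measurable_dgrad p hf k).div_const _)).mul (measurable_dgrad p hm k).abs

namespace IsRademacherSeq

lemma integral_weight (hμ : IsRademacherSeq μ coord p) (k : ℕ) :
    ∫ x, weight p k (x k) ∂μ = 1 := by
  have h := hμ.integral_yValue_sq k
  rw [hμ.integral_comp_coord k (fun t => yValue p k t ^ 2)] at h
  rw [hμ.integral_comp_coord k (weight p k), weight, weight]
  linear_combination h / 2

/-- Independence and mean one: the weight that produces `Γ₀` can be inserted or removed under the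
expectation, as long as the other factor ignores coordinate `k`. -/
lemma integral_weight_mul (hμ : IsRademacherSeq μ coord p) {k : ℕ} {h : (ℕ → ℝ) → ℝ}
    (hh : Measurable h) (hk : ∀ x t, h (Function.update x k t) = h x) :
    ∫ x, weight p k (x k) * h x ∂μ = ∫ x, h x ∂μ := by
  rw [hμ.integral_coord_mul (measurable_weight p k) hh (fun x => hk x 0), hμ.integral_weight,
    one_mul]

lemma integrable_comp_coord_mul (hμ : IsRademacherSeq μ coord p) {k : ℕ} {φ : ℝ → ℝ}
    (hφ : Measurable φ) {h : (ℕ → ℝ) → ℝ} (hi : Integrable h μ) :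
    Integrable (fun x => φ (x k) * h x) μ :=
  (hμ.memLp_top_comp_coord k hφ).integrable_mul (memLp_one_iff_integrable.2 hi)

lemma integral_norm_weight_mul (hμ : IsRademacherSeq μ coord p) {k : ℕ} {h : (ℕ → ℝ) → ℝ}
    (hh : Measurable h) (hk : ∀ x t, h (Function.update x k t) = h x) :
    ∫ x, ‖weight p k (x k) * h x‖ ∂μ = ∫ x, ‖h x‖ ∂μ := by
  simp only [norm_mul, Real.norm_of_nonneg (weight_nonneg p k _)]
  exact hμ.integral_weight_mul hh.norm fun x t => by rw [hk]

lemma remainder_eq (hμ : IsRademacherSeq μ coord p) (f m : (ℕ → ℝ) → ℝ) (z : ℝ) (k : ℕ)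
    (x : ℕ → ℝ) : remainder p f m z k x =
      (steinMono z (f (Function.update x k 1)) - steinMono z (f (Function.update x k (-1)))) *
        dgrad p f k x * |dgrad p m k x| := by
  have h := (Real.sqrt_pos.2 (hμ.mul_one_sub_pos k)).ne'
  rw [remainder, dgrad, mul_assoc, mul_assoc]
  field_simp

/-- The constant is twice the bound on `steinMono`. It does not depend on `z`, which makes the
supremum over `z` finite. -/
lemma abs_remainder_le (hμ : IsRademacherSeq μ coord p) (f m : (ℕ → ℝ) → ℝ) (z : ℝ) (k : ℕ)
    (x : ℕ → ℝ) : |remainder p f m z k x| ≤ 4 * |dgrad p f k x * dgrad p m k x| := by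
  rw [hμ.remainder_eq, abs_mul, abs_mul, abs_mul, abs_abs, mul_assoc]
  refine mul_le_mul_of_nonneg_right ?_ (by positivity)
  have h1 := abs_le.1 (abs_steinMono_le z (f (Function.update x k 1)))
  have h2 := abs_le.1 (abs_steinMono_le z (f (Function.update x k (-1))))
  rw [abs_le]; constructor <;> linarith

/-- The chain rule for the solution of Stein's equation. -/
lemma ae_abs_dgrad_stein_sub_le (hμ : IsRademacherSeq μ coord p) (f m : (ℕ → ℝ) → ℝ) (z : ℝ)
    (k : ℕ) : ∀ᵐ x ∂μ, |dgrad p (fun y => stein z (f y)) k x * dgrad p m k x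
      - steinDeriv z (f x) * (dgrad p f k x * dgrad p m k x)| ≤ remainder p f m z k x := by
  filter_upwards [hμ.ae_coord k] with x hx
  have hu : Function.update x k (x k) = x := Function.update_eq_self k x
  -- Almost surely `x k = ±1`, so `f x` is one of the two endpoint values, as the increment estimate
  -- requires.
  have h := abs_stein_sub_sub_le z (f (Function.update x k (-1))) (f (Function.update x k 1))
    (x := f x) (by rcases hx with hx | hx <;> rw [hx] at hu <;> simp [hu])
  have hs := Real.sqrt_nonneg (p k * (1 - p k))
  have hd : dgrad p f k x = √(p k * (1 - p k)) *
    (f (Function.update x k 1) - f (Function.update x k (-1))) := rfl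
  have hd' : dgrad p (fun y => stein z (f y)) k x = √(p k * (1 - p k)) *
    (stein z (f (Function.update x k 1)) - stein z (f (Function.update x k (-1)))) := rfl
  rw [hμ.remainder_eq, hd, hd']
  calc _ = |√(p k * (1 - p k)) * (stein z (f (Function.update x k 1))
          - stein z (f (Function.update x k (-1))) - steinDeriv z (f x) *
            (f (Function.update x k 1) - f (Function.update x k (-1)))) * dgrad p m k x| := by
        congr 1; ring
    _ = √(p k * (1 - p k)) * |stein z (f (Function.update x k 1))
          - stein z (f (Function.update x k (-1))) - steinDeriv z (f x) *
            (f (Function.update x k 1) - f (Function.update x k (-1)))| * |dgrad p m k x| := by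
        rw [abs_mul, abs_mul, abs_of_nonneg hs]
    _ ≤ √(p k * (1 - p k)) * ((f (Function.update x k 1) - f (Function.update x k (-1))) *
          (steinMono z (f (Function.update x k 1)) - steinMono z (f (Function.update x k (-1)))))
          * |dgrad p m k x| := by gcongr
    _ = _ := by ring

lemma abs_dgrad_stein_le (p : ℕ → ℝ) (f : (ℕ → ℝ) → ℝ) (z : ℝ) (k : ℕ) (x : ℕ → ℝ) :
    |dgrad p (fun y => stein z (f y)) k x| ≤ |dgrad p f k x| := by
  rw [dgrad, dgrad, abs_mul, abs_mul]
  exact mul_le_mul_of_nonneg_left (abs_stein_sub_le z _ _) (abs_nonneg _)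

lemma memLp_stein_comp {f : (ℕ → ℝ) → ℝ} (hf : MemLp f 2 μ) (z : ℝ) :
    MemLp (fun x => stein z (f x)) 2 μ := by
  refine ((memLp_const |stein z 0|).add hf.norm).mono
    ((continuous_stein z).comp_aestronglyMeasurable hf.1) (ae_of_all _ fun x => ?_)
  have h := abs_stein_sub_le z 0 (f x)
  have h2 := abs_sub_abs_le_abs_sub (stein z (f x)) (stein z 0)
  rw [sub_zero] at h
  simp only [Real.norm_eq_abs, Pi.add_apply]
  refine le_trans ?_ (le_abs_self _)
  linarith

lemma integrable_dgrad_mul (hμ : IsRademacherSeq μ coord p) {f m : (ℕ → ℝ) → ℝ}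
    (hf : MemLp f 2 μ) (hm : MemLp m 2 μ) (k : ℕ) :
    Integrable (fun x => dgrad p f k x * dgrad p m k x) μ :=
  (hμ.memLp_dgrad hf k).integrable_mul (hμ.memLp_dgrad hm k)

lemma summable_integral_norm_dgrad_mul (hμ : IsRademacherSeq μ coord p) {f m : (ℕ → ℝ) → ℝ}
    (hf : MemLp f 2 μ) (hm : MemLp m 2 μ)
    (hsf : Summable fun k => ∫ x, dgrad p f k x ^ 2 ∂μ)
    (hsm : Summable fun k => ∫ x, dgrad p m k x ^ 2 ∂μ) :
    Summable fun k => ∫ x, ‖dgrad p f k x * dgrad p m k x‖ ∂μ := by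
  refine (hsf.add hsm).of_nonneg_of_le (fun k => integral_nonneg fun x => norm_nonneg _) fun k => ?_
  have h1 := (hμ.memLp_dgrad hf k).integrable_sq
  have h2 := (hμ.memLp_dgrad hm k).integrable_sq
  rw [← integral_add h1 h2]
  refine integral_mono (hμ.integrable_dgrad_mul hf hm k).norm (h1.add h2) fun x => ?_
  rw [Real.norm_eq_abs, abs_le]
  constructor <;> nlinarith [sq_nonneg (dgrad p f k x + dgrad p m k x),
    sq_nonneg (dgrad p f k x - dgrad p m k x), sq_nonneg (dgrad p f k x),
    sq_nonneg (dgrad p m k x)]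

lemma integrable_remainder (hμ : IsRademacherSeq μ coord p) {f m : (ℕ → ℝ) → ℝ}
    (hf : MemLp f 2 μ) (hfm : Measurable f) (hm : MemLp m 2 μ) (hmm : Measurable m) (z : ℝ)
    (k : ℕ) : Integrable (remainder p f m z k) μ :=
  ((hμ.integrable_dgrad_mul hf hm k).norm.const_mul 4).mono'
    (measurable_remainder p hfm hmm z k).aestronglyMeasurable
    (ae_of_all _ fun x => hμ.abs_remainder_le f m z k x)

lemma integral_norm_remainder_le (hμ : IsRademacherSeq μ coord p) {f m : (ℕ → ℝ) → ℝ}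
    (hf : MemLp f 2 μ) (hfm : Measurable f) (hm : MemLp m 2 μ) (hmm : Measurable m) (z : ℝ)
    (k : ℕ) : ∫ x, ‖remainder p f m z k x‖ ∂μ ≤
      4 * ∫ x, ‖dgrad p f k x * dgrad p m k x‖ ∂μ := by
  rw [← integral_const_mul]
  exact integral_mono (hμ.integrable_remainder hf hfm hm hmm z k).norm
    ((hμ.integrable_dgrad_mul hf hm k).norm.const_mul 4) fun x => hμ.abs_remainder_le f m z k x

lemma summable_integral_norm_remainder (hμ : IsRademacherSeq μ coord p) {f m : (ℕ → ℝ) → ℝ}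
    (hf : MemLp f 2 μ) (hfm : Measurable f) (hm : MemLp m 2 μ) (hmm : Measurable m)
    (hs : Summable fun k => ∫ x, ‖dgrad p f k x * dgrad p m k x‖ ∂μ) (z : ℝ) :
    Summable fun k => ∫ x, ‖remainder p f m z k x‖ ∂μ :=
  (hs.mul_left 4).of_nonneg_of_le (fun _ => integral_nonneg fun _ => norm_nonneg _)
    (hμ.integral_norm_remainder_le hf hfm hm hmm z)

lemma integral_tsum_remainder_le (hμ : IsRademacherSeq μ coord p) {f m : (ℕ → ℝ) → ℝ}
    (hf : MemLp f 2 μ) (hfm : Measurable f) (hm : MemLp m 2 μ) (hmm : Measurable m)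
    (hs : Summable fun k => ∫ x, ‖dgrad p f k x * dgrad p m k x‖ ∂μ) (z : ℝ) :
    ∫ x, ∑' k, remainder p f m z k x ∂μ ≤
      ∑' k, 4 * ∫ x, ‖dgrad p f k x * dgrad p m k x‖ ∂μ := by
  have h1 := hμ.summable_integral_norm_remainder hf hfm hm hmm hs z
  rw [← (hasSum_integral_of_summable_integral_norm
    (hμ.integrable_remainder hf hfm hm hmm z) h1).tsum_eq]
  refine Summable.tsum_le_tsum (fun k => ?_) (hasSum_integral_of_summable_integral_norm
    (hμ.integrable_remainder hf hfm hm hmm z) h1).summable (hs.mul_left 4)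
  exact ((le_abs_self _).trans (norm_integral_le_integral_norm (μ := μ)
    (remainder p f m z k))).trans (hμ.integral_norm_remainder_le hf hfm hm hmm z k)

/-- Stein's equation integrated against the law of `f`; boundedness of `x f_z(x)` lets the integral
be split. -/
lemma integral_stein_eq {f : (ℕ → ℝ) → ℝ} (hfm : Measurable f) (z : ℝ) :
    μ.real {x | f x ≤ z} - Phi z =
      (∫ x, steinDeriv z (f x) ∂μ) - ∫ x, f x * stein z (f x) ∂μ := by
  have hS : MeasurableSet {x | f x ≤ z} := hfm measurableSet_Iic
  have hi : Integrable (fun x => f x * stein z (f x)) μ :=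
    Integrable.of_bound (C := 1)
      ((monotone_mul_stein z).measurable.comp hfm).aestronglyMeasurable (ae_of_all _ fun x => by
        have h1 := mul_stein_le z (f x)
        have h2 := le_mul_stein z (f x)
        have h3 := Phi_nonneg z
        have h4 := Phi_le_one z
        rw [Real.norm_eq_abs, abs_le]; constructor <;> linarith)
  have hind : (fun x => Set.indicator (Set.Iic z) (1 : ℝ → ℝ) (f x)) =
      Set.indicator {x | f x ≤ z} 1 := by
    ext x; simp [Set.indicator]
  have hi2 : Integrable (fun x => Set.indicator (Set.Iic z) (1 : ℝ → ℝ) (f x)) μ := by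
    rw [hind]
    exact (integrable_const (1 : ℝ)).indicator hS
  have h : ∫ x, Set.indicator (Set.Iic z) (1 : ℝ → ℝ) (f x) ∂μ = μ.real {x | f x ≤ z} := by
    rw [hind, MeasureTheory.integral_indicator_one hS]
  have hi3 : Integrable (fun x => f x * stein z (f x) +
      Set.indicator (Set.Iic z) (1 : ℝ → ℝ) (f x)) μ := hi.add hi2
  simp only [steinDeriv]
  rw [integral_sub hi3 (integrable_const _), integral_add hi hi2, h]
  simp
  ring

/-- The Malliavin-Stein bound at a fixed level `z`. -/
lemma abs_measureReal_sub_Phi_le (hμ : IsRademacherSeq μ coord p) {f m : (ℕ → ℝ) → ℝ}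
    (hf : MemLp f 2 μ) (hfm : Measurable f) (hm : MemLp m 2 μ) (hmm : Measurable m)
    (hf0 : ∫ x, f x ∂μ = 0)
    (h : ∀ A : Finset ℕ, A.Nonempty → (A.card : ℝ) * walshCoef μ p m A = walshCoef μ p f A)
    (hs : Summable fun k => ∫ x, ‖dgrad p f k x * dgrad p m k x‖ ∂μ) (z : ℝ) :
    |μ.real {x | f x ≤ z} - Phi z| ≤
      (∫ x, |1 - ∑' k, weight p k (x k) * (dgrad p f k x * dgrad p m k x)| ∂μ)
        + ∫ x, ∑' k, remainder p f m z k x ∂μ := by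
  have hg := memLp_stein_comp hf z
  have hgm : Measurable fun x => stein z (f x) := (continuous_stein z).measurable.comp hfm
  -- the three weighted series
  have hai := fun k => hμ.integrable_comp_coord_mul (k := k) (measurable_weight p k)
    (hμ.integrable_dgrad_mul hf hm k)
  have hui := fun k => hμ.integrable_comp_coord_mul (k := k) (measurable_weight p k)
    (hμ.integrable_dgrad_mul hg hm k)
  have hri := fun k => hμ.integrable_comp_coord_mul (k := k) (measurable_weight p k)
    (hμ.integrable_remainder hf hfm hm hmm z k)
  have has : Summable fun k =>
      ∫ x, ‖weight p k (x k) * (dgrad p f k x * dgrad p m k x)‖ ∂μ := by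
    refine hs.congr fun k => (hμ.integral_norm_weight_mul (h := fun x =>
      dgrad p f k x * dgrad p m k x) ((measurable_dgrad p hfm k).mul (measurable_dgrad p hmm k))
      fun x t => by simp [dgrad_update]).symm
  have hus0 : Summable fun k =>
      ∫ x, ‖dgrad p (fun y => stein z (f y)) k x * dgrad p m k x‖ ∂μ := by
    refine hs.of_nonneg_of_le (fun k => integral_nonneg fun x => norm_nonneg _) fun k => ?_
    refine integral_mono (hμ.integrable_dgrad_mul hg hm k).norm
      (hμ.integrable_dgrad_mul hf hm k).norm fun x => ?_
    simp only [norm_mul]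
    exact mul_le_mul_of_nonneg_right (abs_dgrad_stein_le p f z k x) (norm_nonneg _)
  have hus : Summable fun k => ∫ x, ‖weight p k (x k) *
      (dgrad p (fun y => stein z (f y)) k x * dgrad p m k x)‖ ∂μ := by
    refine hus0.congr fun k => (hμ.integral_norm_weight_mul (h := fun x =>
      dgrad p (fun y => stein z (f y)) k x * dgrad p m k x)
      ((measurable_dgrad p hgm k).mul (measurable_dgrad p hmm k))
      fun x t => by simp [dgrad_update]).symm
  have hrs0 := hμ.summable_integral_norm_remainder hf hfm hm hmm hs z
  have hrs : Summable fun k => ∫ x, ‖weight p k (x k) * remainder p f m z k x‖ ∂μ :=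
    hrs0.congr fun k => (hμ.integral_norm_weight_mul (measurable_remainder p hfm hmm z k)
      (remainder_update p f m z k)).symm
  have hui' := integrable_tsum_of_summable_integral_norm hui hus
  have hai' := integrable_tsum_of_summable_integral_norm hai has
  have hri' := integrable_tsum_of_summable_integral_norm hri hrs
  -- integration by parts
  have hU : ∫ x, f x * stein z (f x) ∂μ = ∫ x, ∑' k, weight p k (x k) *
      (dgrad p (fun y => stein z (f y)) k x * dgrad p m k x) ∂μ := by
    have h1 := hμ.hasSum_integral_dgrad_mul_of_walshCoef hf hg hgm hm hmm hf0 h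
    have h2 := hasSum_integral_of_summable_integral_norm hui hus
    -- The weight must enter before the chain rule is applied: `f_z'(F)` depends on coordinate `k`,
    -- so it could not be inserted afterwards.
    have h3 : ∀ k, ∫ x, weight p k (x k) *
        (dgrad p (fun y => stein z (f y)) k x * dgrad p m k x) ∂μ =
        ∫ x, dgrad p (fun y => stein z (f y)) k x * dgrad p m k x ∂μ := fun k =>
      hμ.integral_weight_mul (h := fun x => dgrad p (fun y => stein z (f y)) k x * dgrad p m k x)
        ((measurable_dgrad p hgm k).mul (measurable_dgrad p hmm k))
        fun x t => by simp [dgrad_update]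
    simp only [h3] at h2
    rw [← h1.unique h2]
    simp only [mul_comm]
  -- The remainder ignores coordinate `k`, hence the weight can be dropped again.
  have hR : ∫ x, ∑' k, weight p k (x k) * remainder p f m z k x ∂μ =
      ∫ x, ∑' k, remainder p f m z k x ∂μ := by
    have h1 := hasSum_integral_of_summable_integral_norm
      (hμ.integrable_remainder hf hfm hm hmm z) hrs0
    have h2 := hasSum_integral_of_summable_integral_norm hri hrs
    simp only [hμ.integral_weight_mul (measurable_remainder p hfm hmm z _)
      (remainder_update p f m z _)] at h2
    exact h2.unique h1
  have hdi : Integrable (fun x => steinDeriv z (f x)) μ :=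
    Integrable.of_bound (C := 1) ((measurable_steinDeriv z).comp hfm).aestronglyMeasurable
      (ae_of_all _ fun x => abs_steinDeriv_le z (f x))
  have hGi : Integrable (fun x =>
      |1 - ∑' k, weight p k (x k) * (dgrad p f k x * dgrad p m k x)|) μ :=
    ((integrable_const (1 : ℝ)).sub hai').abs
  rw [integral_stein_eq hfm, hU, ← integral_sub hdi hui', ← hR,
    ← integral_add hGi hri']
  refine abs_integral_le_integral_abs.trans ?_
  refine integral_mono_ae (hdi.sub hui').abs (hGi.add hri') ?_
  filter_upwards [ae_summable_of_summable_integral_norm hui hus,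
    ae_summable_of_summable_integral_norm hai has, ae_summable_of_summable_integral_norm hri hrs,
    ae_all_iff.2 (hμ.ae_abs_dgrad_stein_sub_le f m z)] with x hx1 hx2 hx3 hx4
  -- The chain rule is applied summand by summand; the nonnegative weights preserve the inequality.
  have e1 : |(∑' k, weight p k (x k) * (dgrad p (fun y => stein z (f y)) k x * dgrad p m k x))
      - steinDeriv z (f x) * ∑' k, weight p k (x k) * (dgrad p f k x * dgrad p m k x)| ≤
      ∑' k, weight p k (x k) * remainder p f m z k x := by
    rw [← tsum_mul_left, ← hx1.tsum_sub (hx2.mul_left _), ← Real.norm_eq_abs]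
    refine tsum_of_norm_bounded hx3.hasSum fun k => ?_
    have := mul_le_mul_of_nonneg_left (hx4 k) (weight_nonneg p k (x k))
    rw [← abs_of_nonneg (weight_nonneg p k (x k)), ← abs_mul,
      abs_of_nonneg (weight_nonneg p k (x k))] at this
    rw [Real.norm_eq_abs]
    refine le_trans (le_of_eq ?_) this
    congr 1; ring
  set U := ∑' k, weight p k (x k) * (dgrad p (fun y => stein z (f y)) k x * dgrad p m k x)
  set G := ∑' k, weight p k (x k) * (dgrad p f k x * dgrad p m k x)
  have e2 : |steinDeriv z (f x) * (1 - G)| ≤ |1 - G| := by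
    rw [abs_mul]
    exact mul_le_of_le_one_left (abs_nonneg _) (abs_steinDeriv_le z (f x))
  calc |steinDeriv z (f x) - U| =
        |steinDeriv z (f x) * (1 - G) - (U - steinDeriv z (f x) * G)| := by congr 1; ring
    _ ≤ |steinDeriv z (f x) * (1 - G)| + |U - steinDeriv z (f x) * G| := abs_sub _ _
    _ ≤ _ := add_le_add e2 e1

end IsRademacherSeq
end Rademacher

namespace Rademacher
set_option linter.unusedSectionVars false

/-! ### Transfer to the probability space -/

variable {Ω : Type*} [MeasurableSpace Ω] {P : Measure Ω} [IsProbabilityMeasure P]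
  {X : ℕ → Ω → ℝ} {p : ℕ → ℝ}

lemma IsRepr.neg {F : Ω → ℝ} {f : (ℕ → ℝ) → ℝ} (h : IsRepr P X F f) :
    IsRepr P X (-F) fun x => -f x := by
  refine ⟨h.1.neg, ?_⟩
  filter_upwards [h.2] with ω hω
  rw [Pi.neg_apply, hω]

namespace IsRademacherSeq

lemma measurePreserving (hX : IsRademacherSeq P X p) :
    MeasurePreserving (fun ω j => X j ω) P (P.map fun ω j => X j ω) :=
  ⟨hX.measurable_seq, rfl⟩

lemma memLp_of_isRepr (hX : IsRademacherSeq P X p) {F : Ω → ℝ} {f : (ℕ → ℝ) → ℝ}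
    (hF : MemLp F 2 P) (hf : IsRepr P X F f) : MemLp f 2 (P.map fun ω j => X j ω) :=
  (memLp_map_measure_iff hf.1.aestronglyMeasurable hX.measurable_seq.aemeasurable).2
    (hF.ae_eq hf.2)

lemma integral_of_isRepr (hX : IsRademacherSeq P X p) {F : Ω → ℝ} {f : (ℕ → ℝ) → ℝ}
    (hf : IsRepr P X F f) : ∫ ω, F ω ∂P = ∫ x, f x ∂(P.map fun ω j => X j ω) := by
  rw [integral_congr_ae hf.2,
    integral_map hX.measurable_seq.aemeasurable hf.1.aestronglyMeasurable]

lemma grad_ae_eq_dgrad (hX : IsRademacherSeq P X p) {F : Ω → ℝ} {f : (ℕ → ℝ) → ℝ}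
    (hf : IsRepr P X F f) : ∀ᵐ ω ∂P, ∀ k, grad P X p F k ω = dgrad p f k fun j => X j ω :=
  ae_all_iff.2 fun k => grad_ae_eq hX hf k

lemma J_ae_eq (hX : IsRademacherSeq P X p) {n : ℕ} {g : (Fin n → ℕ) → ℝ}
    (hg : Summable fun i => g i ^ 2) : J P X p n g =ᵐ[P]
      fun ω => J (P.map fun ω j => X j ω) coord p n g fun j => X j ω := by
  have := Measure.isProbabilityMeasure_map (μ := P) hX.measurable_seq.aemeasurable
  have hm := hX.map.memLp_multipleIntegral_summand g
  have h := (isL2Sum_comp_iff hX.measurePreserving (fun i => (hm i).1)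
    (hX.map.isL2Sum_J hg).1.1).2 (hX.map.isL2Sum_J hg)
  exact h.l2Sum.ae_eq (fun i => (hm i).comp_measurePreserving hX.measurePreserving) h

/-- The same kernels serve on both spaces, as composition with `X` preserves `L²` convergence and
multiple integrals up to null sets. -/
lemma isChaosExpansion_iff (hX : IsRademacherSeq P X p) {F : Ω → ℝ} {f : (ℕ → ℝ) → ℝ}
    (hF : MemLp F 2 P) (hf : IsRepr P X F f) {g : (n : ℕ+) → (Fin n → ℕ) → ℝ} :
    IsChaosExpansion P X p F g ↔
      IsChaosExpansion (P.map fun ω j => X j ω) coord p f g := by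
  have := Measure.isProbabilityMeasure_map (μ := P) hX.measurable_seq.aemeasurable
  refine and_congr_right fun hg => ?_
  have h0 : AEStronglyMeasurable (fun x => f x - ∫ ω', F ω' ∂P) (P.map fun ω j => X j ω) :=
    (hX.memLp_of_isRepr hF hf).1.sub aestronglyMeasurable_const
  rw [← hX.integral_of_isRepr hf, ← isL2Sum_comp_iff hX.measurePreserving
    (fun n : ℕ+ => (hX.map.isL2Sum_J (hg n).summable_sq).1.1) h0]
  have h1 : ∀ n : ℕ+, _ := fun n => hX.J_ae_eq (hg n).summable_sq
  have h2 : (fun ω => F ω - ∫ ω', F ω' ∂P) =ᵐ[P] fun ω => f (fun j => X j ω) - ∫ ω', F ω' ∂P := by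
    filter_upwards [hf.2] with ω hω
    rw [hω]
  exact ⟨fun h => h.congr h1 h2, fun h => h.congr (fun n => (h1 n).symm) h2.symm⟩

/-- `-L⁻¹ F` in terms of Walsh coefficients on the sequence space. -/
lemma exists_isRepr_invL (hX : IsRademacherSeq P X p) {F : Ω → ℝ} {f : (ℕ → ℝ) → ℝ}
    (hF : MemLp F 2 P) (hf : IsRepr P X F f) :
    ∃ m, IsRepr P X (invL P X p F) m ∧ MemLp m 2 (P.map fun ω j => X j ω) ∧
      ∀ A : Finset ℕ, A.Nonempty → (A.card : ℝ) *
        walshCoef (P.map fun ω j => X j ω) p m A =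
          -walshCoef (P.map fun ω j => X j ω) p f A := by
  have := Measure.isProbabilityMeasure_map (μ := P) hX.measurable_seq.aemeasurable
  have hf2 := hX.memLp_of_isRepr hF hf
  -- Existence is pulled back from the sequence space, so `invL` takes its first branch; the kernels
  -- it picks may differ from `chaosKernel`, hence the need for a statement about any expansion.
  have hex : ∃ g, IsChaosExpansion P X p F g :=
    ⟨_, (hX.isChaosExpansion_iff hF hf).2 (hX.map.isChaosExpansion_chaosKernel hf2)⟩
  have hg := (hX.isChaosExpansion_iff hF hf).1 hex.choose_spec
  obtain ⟨S, hS, hcoef⟩ := hX.map.exists_isL2Sum_invL hf2 hg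
  have hJ : ∀ n : ℕ+, MemLp (J (P.map fun ω j => X j ω) coord p n (hex.choose n)) 2
      (P.map fun ω j => X j ω) := fun n => (hX.map.isL2Sum_J (hg.1 n).summable_sq).1
  have hJc : ∀ n : ℕ+, MemLp (fun x => -(1 / (n : ℝ)) *
      J (P.map fun ω j => X j ω) coord p n (hex.choose n) x) 2 (P.map fun ω j => X j ω) :=
    fun n => (hJ n).const_mul _
  have hJP : ∀ n : ℕ+, (fun ω => -(1 / (n : ℝ)) * J (P.map fun ω j => X j ω) coord p n
      (hex.choose n) (fun j => X j ω)) =ᵐ[P]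
      fun ω => -(1 / (n : ℝ)) * J P X p n (hex.choose n) ω := by
    intro n
    filter_upwards [hX.J_ae_eq (hg.1 n).summable_sq] with ω hω
    rw [hω]
  have h1 := ((isL2Sum_comp_iff hX.measurePreserving (fun n => (hJc n).1) hS.1.1).2 hS).congr
    hJP ae_eq_rfl
  have h2 : invL P X p F =ᵐ[P] fun ω => S fun j => X j ω := by
    rw [invL, dif_pos hex]
    exact h1.l2Sum.ae_eq (fun n => ((hJc n).comp_measurePreserving
      hX.measurePreserving).ae_eq (hJP n)) h1
  -- An `L²` sum is only almost everywhere measurable; a representation requires a measurable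
  -- version.
  obtain ⟨m, hm, hSm⟩ := hS.1.1.aemeasurable
  refine ⟨m, ⟨hm, ?_⟩, hS.1.ae_eq hSm, fun A hA => ?_⟩
  · filter_upwards [h2, hX.measurePreserving.quasiMeasurePreserving.ae hSm] with ω h3 h4
    rw [h3, h4]
  · rw [← hcoef A hA]
    congr 1
    refine integral_congr_ae ?_
    filter_upwards [hSm] with x hx
    rw [hx]

lemma summable_integral_dgrad_sq_of_memD12 (hX : IsRademacherSeq P X p) {F : Ω → ℝ}
    {f : (ℕ → ℝ) → ℝ} (hF : MemD12 P X p F) (hf : IsRepr P X F f) :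
    Summable fun k => ∫ x, dgrad p f k x ^ 2 ∂(P.map fun ω j => X j ω) := by
  have := Measure.isProbabilityMeasure_map (μ := P) hX.measurable_seq.aemeasurable
  have hf2 := hX.memLp_of_isRepr hF.1.1 hf
  have hm : ∀ k, Measurable fun x => ENNReal.ofReal (dgrad p f k x ^ 2) := fun k =>
    ((measurable_dgrad p hf.1 k).pow_const 2).ennreal_ofReal
  have h := hF.2
  have h1 : ∫⁻ ω, ∑' k, ENNReal.ofReal (grad P X p F k ω ^ 2) ∂P =
      ∑' k, ENNReal.ofReal (∫ x, dgrad p f k x ^ 2 ∂(P.map fun ω j => X j ω)) := by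
    calc _ = ∫⁻ ω, ∑' k, ENNReal.ofReal (dgrad p f k (fun j => X j ω) ^ 2) ∂P := by
          refine lintegral_congr_ae ?_
          filter_upwards [hX.grad_ae_eq_dgrad hf] with ω hω
          simp only [hω]
      _ = ∑' k, ∫⁻ ω, ENNReal.ofReal (dgrad p f k (fun j => X j ω) ^ 2) ∂P :=
          lintegral_tsum fun k => ((hm k).comp hX.measurable_seq).aemeasurable
      _ = _ := by
          refine tsum_congr fun k => ?_
          rw [ofReal_integral_eq_lintegral_ofReal (hX.map.memLp_dgrad hf2 k).integrable_sq
            (ae_of_all _ fun x => sq_nonneg _), lintegral_map (hm k) hX.measurable_seq]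
  rw [h1] at h
  refine (ENNReal.summable_toReal h.ne).congr fun k => ?_
  rw [ENNReal.toReal_ofReal (integral_nonneg fun x => sq_nonneg _)]

end IsRademacherSeq
end Rademacher

/-! ### Assembly of the theorem -/

open Rademacher in
theorem theorem3p4 {Ω : Type*} [MeasurableSpace Ω] (P : MeasureTheory.Measure Ω)
    [MeasureTheory.IsProbabilityMeasure P] (X : ℕ → Ω → ℝ) (p : ℕ → ℝ)
    (hX : IsRademacherSeq P X p)
    (F : Ω → ℝ) (hF : MemD12 P X p F)
    (hmean : ∫ ω, F ω ∂P = 0) (hvar : ProbabilityTheory.variance F P = 1)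
    (hG : ∀ z : ℝ, MemD12 P X p (steinVar F z))
    {Ω' : Type*} [MeasurableSpace Ω'] (Q : MeasureTheory.Measure Ω')
    (N : Ω' → ℝ) (hN : ProbabilityTheory.HasLaw N (ProbabilityTheory.gaussianReal 0 1) Q) :
    -- the two series in `Γ₀(F, -L⁻¹F)` converge and the first expectation is finite
    (∀ᵐ ω ∂P, Summable fun k => grad P X p F k ω * grad P X p (-invL P X p F) k ω) ∧
    (∀ᵐ ω ∂P, Summable fun k =>
      grad P X p F k ω * grad P X p (-invL P X p F) k ω * Y X p k ω ^ 2) ∧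
    MeasureTheory.Integrable (fun ω => 1 - Gamma0 P X p F (-invL P X p F) ω) P ∧
    -- the inner products converge, their expectations are finite and so is the supremum
    (∀ z : ℝ, ∀ᵐ ω ∂P, Summable fun k => remTerm P X p F z k ω) ∧
    (∀ z : ℝ, MeasureTheory.Integrable (fun ω => ∑' k, remTerm P X p F z k ω) P) ∧
    BddAbove (Set.range fun z : ℝ => ∫ ω, ∑' k, remTerm P X p F z k ω ∂P) ∧
    -- the bound
    dK P F Q N ≤ ∫ ω, |1 - Gamma0 P X p F (-invL P X p F) ω| ∂P
      + ⨆ z : ℝ, ∫ ω, ∑' k, remTerm P X p F z k ω ∂P := by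
  obtain ⟨f, hf⟩ := hF.1.2
  obtain ⟨l, hl, hl2, hcoef⟩ := hX.exists_isRepr_invL hF.1.1 hf
  have hmp := hX.measurePreserving
  have hTae := hX.measurable_seq.aemeasurable (μ := P)
  have hμP := Measure.isProbabilityMeasure_map (μ := P) hTae
  have hμ := hX.map
  have hf2 := hX.memLp_of_isRepr hF.1.1 hf
  have hsf := hX.summable_integral_dgrad_sq_of_memD12 hF hf
  have hgF := hX.grad_ae_eq_dgrad hf
  have hgL := hX.grad_ae_eq_dgrad hl
  have hgM := hX.grad_ae_eq_dgrad hl.neg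
  have hgS : ∀ z, ∀ᵐ ω ∂P, ∀ k, grad P X p (steinVar F z) k ω =
      dgrad p (fun y => steinMono z (f y)) k fun j => X j ω := by
    intro z
    refine hX.grad_ae_eq_dgrad ⟨(measurable_steinMono z).comp hf.1, ?_⟩
    filter_upwards [hf.2] with ω hω
    rw [steinVar, steinMono, hω]
  have hf0 : ∫ x, f x ∂(P.map fun ω j => X j ω) = 0 := by rw [← hX.integral_of_isRepr hf, hmean]
  have hprob : ∀ z, P.real {ω | F ω ≤ z} =
      (P.map fun ω j => X j ω).real {x | f x ≤ z} := by
    intro z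
    have hS : MeasurableSet {x | f x ≤ z} := hf.1 measurableSet_Iic
    rw [map_measureReal_apply hX.measurable_seq hS]
    refine measureReal_congr ?_
    filter_upwards [hf.2] with ω hω
    change (F ω ≤ z) = (f (fun j => X j ω) ≤ z)
    rw [hω]
  have hQ : ∀ z, Q.real {ω | N ω ≤ z} = Phi z := by
    intro z
    rw [Phi, ← hN.map_eq, map_measureReal_apply_of_aemeasurable hN.aemeasurable measurableSet_Iic]
    rfl
  generalize hμdef : (P.map fun ω j => X j ω) = μ at *
  -- The sign is moved into `m`, which represents `-L⁻¹F`; the remainder contains only `|D_k L⁻¹F|`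
  -- and does not notice.
  set m : (ℕ → ℝ) → ℝ := fun x => -l x with hm
  have hmm : Measurable m := hl.1.neg
  have hm2 : MemLp m 2 μ := hl2.neg
  have hcoefm : ∀ A : Finset ℕ, A.Nonempty →
      (A.card : ℝ) * walshCoef μ p m A = walshCoef μ p f A := by
    intro A hA
    have : walshCoef μ p m A = -walshCoef μ p l A := by
      simp only [walshCoef, hm, neg_mul, integral_neg]
    rw [this, mul_neg, hcoef A hA, neg_neg]
  have hs := hμ.summable_integral_norm_dgrad_mul hf2 hm2 hsf
    (hμ.summable_integral_dgrad_sq hf2 hm2 hmm hcoefm)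
  have hdl : ∀ k x, |dgrad p l k x| = |dgrad p m k x| := by
    intro k x
    rw [← abs_neg]; congr 1
    simp only [dgrad, hm]; ring
  have hrem : ∀ z, ∀ᵐ ω ∂P, ∀ k, remTerm P X p F z k ω =
      remainder p f m z k fun j => X j ω := by
    intro z
    filter_upwards [hgF, hgL, hgS z] with ω h1 h2 h3 k
    rw [remTerm, remainder, h1, h2, h3, hdl]
  -- convergence of the series
  have hri := hμ.integrable_remainder hf2 hf.1 hm2 hmm
  have hrs := hμ.summable_integral_norm_remainder hf2 hf.1 hm2 hmm hs
  have hai := hμ.integrable_dgrad_mul hf2 hm2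
  have hyi : ∀ k, Integrable (fun x =>
      yValue p k (x k) ^ 2 * (dgrad p f k x * dgrad p m k x)) μ := fun k =>
    hμ.integrable_comp_coord_mul (φ := fun t => yValue p k t ^ 2)
      ((measurable_yValue p k).pow_const 2) (hai k)
  have hys : Summable fun k =>
      ∫ x, ‖yValue p k (x k) ^ 2 * (dgrad p f k x * dgrad p m k x)‖ ∂μ := by
    refine hs.congr fun k => ?_
    simp only [norm_mul (_ ^ 2), norm_pow, Real.norm_eq_abs, sq_abs]
    exact (hμ.integral_yValue_sq_mul
      (((measurable_dgrad p hf.1 k).mul (measurable_dgrad p hmm k)).abs)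
      fun x t => by simp [dgrad_update]).symm
  have sa := hmp.quasiMeasurePreserving.ae (ae_summable_of_summable_integral_norm hai hs)
  have sy := hmp.quasiMeasurePreserving.ae (ae_summable_of_summable_integral_norm hyi hys)
  have ia := integrable_tsum_of_summable_integral_norm hai hs
  have iy := integrable_tsum_of_summable_integral_norm hyi hys
  -- The two halves of `Γ₀` merge into one weighted series, which needs almost sure convergence of
  -- each.
  have hΓμ : ∀ᵐ x ∂μ, ∑' k, weight p k (x k) * (dgrad p f k x * dgrad p m k x) =
      1 / 2 * ∑' k, dgrad p f k x * dgrad p m k x +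
        1 / 2 * ∑' k, yValue p k (x k) ^ 2 * (dgrad p f k x * dgrad p m k x) := by
    filter_upwards [ae_summable_of_summable_integral_norm hai hs,
      ae_summable_of_summable_integral_norm hyi hys] with x h1 h2
    rw [← tsum_mul_left, ← tsum_mul_left, ← (h1.mul_left _).tsum_add (h2.mul_left _)]
    refine tsum_congr fun k => ?_
    rw [weight]; ring
  have iΓ : Integrable (fun x =>
      1 - ∑' k, weight p k (x k) * (dgrad p f k x * dgrad p m k x)) μ := by
    refine ((integrable_const (1 : ℝ)).sub
      ((ia.const_mul (1 / 2)).add (iy.const_mul (1 / 2)))).congr ?_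
    filter_upwards [hΓμ] with x hx
    rw [hx]; rfl
  have hΓ : (fun ω => 1 - Gamma0 P X p F (-invL P X p F) ω) =ᵐ[P] fun ω =>
      (fun x : ℕ → ℝ => 1 - ∑' k, weight p k (x k) * (dgrad p f k x * dgrad p m k x))
        fun j => X j ω := by
    filter_upwards [hgF, hgM, hmp.quasiMeasurePreserving.ae hΓμ] with ω h1 h2 h3
    simp only [Gamma0, h1, h2, h3, mul_comm _ (Y X p _ ω ^ 2)]
    rfl
  have hintrem : ∀ z, ∫ ω, ∑' k, remTerm P X p F z k ω ∂P =
      ∫ x, ∑' k, remainder p f m z k x ∂μ := by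
    intro z
    subst hμdef
    rw [integral_map hTae (integrable_tsum_of_summable_integral_norm (hri z) (hrs z)).1]
    refine integral_congr_ae ?_
    filter_upwards [hrem z] with ω hω
    simp only [hω]
  have hintΓ : ∫ ω, |1 - Gamma0 P X p F (-invL P X p F) ω| ∂P =
      ∫ x, |1 - ∑' k, weight p k (x k) * (dgrad p f k x * dgrad p m k x)| ∂μ := by
    subst hμdef
    rw [integral_map hTae iΓ.abs.1]
    refine integral_congr_ae ?_
    filter_upwards [hΓ] with ω hω
    rw [hω]
  have hbdd : BddAbove (Set.range fun z : ℝ => ∫ ω, ∑' k, remTerm P X p F z k ω ∂P) := by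
    -- This upper bound does not involve `z`.
    refine ⟨∑' k, 4 * ∫ x, ‖dgrad p f k x * dgrad p m k x‖ ∂μ, ?_⟩
    rintro _ ⟨z, rfl⟩
    simp only [hintrem]
    exact hμ.integral_tsum_remainder_le hf2 hf.1 hm2 hmm hs z
  refine ⟨?_, ?_, ?_, fun z => ?_, fun z => ?_, hbdd, ?_⟩
  · filter_upwards [hgF, hgM, sa] with ω h1 h2 h3
    simpa only [h1, h2] using h3
  · filter_upwards [hgF, hgM, sy] with ω h1 h2 h3
    refine h3.congr fun k => ?_
    rw [h1, h2, mul_comm]; rfl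
  · exact ((hmp.integrable_comp iΓ.1).2 iΓ).congr hΓ.symm
  · filter_upwards [hrem z, hmp.quasiMeasurePreserving.ae
      (ae_summable_of_summable_integral_norm (hri z) (hrs z))] with ω h1 h2
    simpa only [h1] using h2
  · have i := integrable_tsum_of_summable_integral_norm (hri z) (hrs z)
    refine ((hmp.integrable_comp i.1).2 i).congr ?_
    filter_upwards [hrem z] with ω h1
    simp only [h1, Function.comp]
  · refine ciSup_le fun z => ?_
    rw [hprob, hQ, hintΓ]
    refine (hμ.abs_measureReal_sub_Phi_le hf2 hf.1 hm2 hmm hf0 hcoefm hs z).trans ?_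
    rw [← hintrem z]
    exact add_le_add_right (le_ciSup hbdd z) _
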